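/- Let $G$ be an essential finite reflection group acting on $V=\mathbb R^n$: a finite group of orthogonal transformations generated by reflections that fixes no nonzero vector. For a reflection group $W$ on $V$, let $d_1(W)\le\dots\le d_n(W)$ be the degrees of a set of basic invariants of $W$, that is, of algebraically independent homogeneous generators $\pi_1,\dots,\pi_n$ of $\mathbb R[V]^W$, labelled by weakly increasing degree; a point is called $W$-general if it lies on no reflection hyperplane of $W$. Let $\mathcal H_i$ be the set of points of $V$ that lie in an $i$-dimensional intersection of reflection hyperplanes of $G$ (so $\mathcal H_n=V$, the empty intersection). For an integer $d\ge 0$ let $\ell(d)$ be the smallest $\ell\ge 0$ such that for every $p\in V\setminus\mathcal H_{\ell}$ there is a reflection subgroup $G'\subseteq G$ such that $p$ is $G'$-general and $2d_n(G')>d$. For $1\le k\le n$ put $\ell'(k)=\ell(2d_k(G))$. For $f\in\mathbb R[V]^G$ write $V_{\mathbb R}(f)=\{x\in V: f(x)=0\}$, and call $f$ $G$-finite if $V_{\mathbb R}(f)=\emptyset$ or there is $p\in V_{\mathbb R}(f)$ such that the restriction of $f$ to the sphere $\{q\in V:\|q\|=\|p\|\}$ has only finitely many extreme points (points at which the restriction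 attains its maximum or its minimum). **Theorem.** Let $f\in\mathbb R[V]^G$ be $G$-finite and $X=V_{\mathbb R}(f)$. 1. If $f\in\mathbb R[\pi_1,\dots,\pi_k]$ for some set of basic invariants $\pi_1,\dots,\pi_n$ of $G$ and some $1\le k\le n$, then $X\ne\emptyset$ if and only if $X\cap\mathcal H_{\ell'(k)}\neq\emptyset$. 2. Let $d=\deg f$ (with $\deg 0=0$). If $d\notin\{2,3\}$, then $X\neq\emptyset$ if and only if $X\cap\mathcal H_{\ell(d)}\neq\emptyset$. If $d\in\{2,3\}$, then $X\neq\emptyset$ if and only if $X\cap\mathcal H_{1}\neq\emptyset$. -/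

import Mathlib

namespace ReflectionVariety

/-- The Euclidean space `V = ℝⁿ`. -/
abbrev V (n : ℕ) : Type := EuclideanSpace ℝ (Fin n)

/-- The value of a polynomial `f ∈ ℝ[V]` at a point of `V`. -/
noncomputable def value {n : ℕ} (f : MvPolynomial (Fin n) ℝ) (x : V n) : ℝ :=
  MvPolynomial.eval x.ofLp f

/-- The linear hyperplane orthogonal to `v` (a hyperplane when `v ≠ 0`). -/
noncomputable def hyperplane {n : ℕ} (v : V n) : Submodule ℝ (V n) := (Submodule.span ℝ {v})ᗮ

/-- A (linear, orthogonal) reflection: it fixes the hyperplane orthogonal to some nonzero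
vector `v` and sends `v` to `-v`. -/
def IsReflection {n : ℕ} (g : V n ≃ₗᵢ[ℝ] V n) : Prop :=
  ∃ v : V n, v ≠ 0 ∧ g = (hyperplane v).reflection

/-- A finite reflection group: a finite group of orthogonal transformations that is generated
by the reflections it contains. -/
structure IsReflectionGroup {n : ℕ} (G : Subgroup (V n ≃ₗᵢ[ℝ] V n)) : Prop where
  finite : Finite G
  generated : Subgroup.closure {g | g ∈ G ∧ IsReflection g} = G

/-- `G` is essential if no nonzero vector is fixed by all of `G`. -/
def IsEssential {n : ℕ} (G : Subgroup (V n ≃ₗᵢ[ℝ] V n)) : Prop :=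
  ∀ x : V n, (∀ g ∈ G, g x = x) → x = 0

/-- The reflection arrangement of `G`: the set of all reflection hyperplanes of `G`. -/
def arrangement {n : ℕ} (G : Subgroup (V n ≃ₗᵢ[ℝ] V n)) : Set (Submodule ℝ (V n)) :=
  {H | ∃ v : V n, v ≠ 0 ∧ (hyperplane v).reflection ∈ G ∧ H = hyperplane v}

/-- The flats of the reflection arrangement: the intersections of families of reflection
hyperplanes. The empty family gives `V` itself. -/
def IsFlat {n : ℕ} (G : Subgroup (V n ≃ₗᵢ[ℝ] V n)) (F : Submodule ℝ (V n)) : Prop :=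
  ∃ S : Set (Submodule ℝ (V n)), S ⊆ arrangement G ∧ F = sInf S

/-- The closed stratum: the points contained in a flat of dimension `i`. -/
def stratum {n : ℕ} (G : Subgroup (V n ≃ₗᵢ[ℝ] V n)) (i : ℕ) : Set (V n) :=
  {p | ∃ F : Submodule ℝ (V n), IsFlat G F ∧ Module.finrank ℝ F = i ∧ p ∈ F}

/-- A point is `G`-general if it lies on no reflection hyperplane of `G`. -/
def IsGeneral {n : ℕ} (G : Subgroup (V n ≃ₗᵢ[ℝ] V n)) (p : V n) : Prop :=
  ∀ H ∈ arrangement G, p ∉ H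

/-- The ring `ℝ[V]^G` of `G`-invariant polynomials. Over `ℝ` a polynomial is determined by its
values, so invariance is expressed through values. -/
noncomputable def invariants {n : ℕ} (G : Subgroup (V n ≃ₗᵢ[ℝ] V n)) :
    Subalgebra ℝ (MvPolynomial (Fin n) ℝ) where
  carrier := {f | ∀ g ∈ G, ∀ x : V n, value f (g x) = value f x}
  mul_mem' := by
    intro a b ha hb g hg x
    have h1 := ha g hg x
    have h2 := hb g hg x
    simp only [value] at h1 h2
    simp only [value, map_mul, h1, h2]
  add_mem' := by
    intro a b ha hb g hg x
    have h1 := ha g hg x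
    have h2 := hb g hg x
    simp only [value] at h1 h2
    simp only [value, map_add, h1, h2]
  algebraMap_mem' := by
    intro r g _ x
    simp [value, MvPolynomial.algebraMap_eq]

/-- A set of basic invariants of `G`: homogeneous, algebraically independent generators of
`ℝ[V]^G`, labelled by weakly increasing degree. Their degrees are the degrees
`d₁(G) ≤ … ≤ dₙ(G)` of `G`. -/
structure IsBasicInvariants {n : ℕ} (G : Subgroup (V n ≃ₗᵢ[ℝ] V n))
    (π : Fin n → MvPolynomial (Fin n) ℝ) : Prop where
  homogeneous : ∀ i, (π i).IsHomogeneous (π i).totalDegree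
  algebraicIndependent : AlgebraicIndependent ℝ π
  generates : Algebra.adjoin ℝ (Set.range π) = invariants G
  ordered : Monotone fun i => (π i).totalDegree

/-- The assertion `d < 2 dₙ(G)`, where `dₙ(G)` is the largest degree of a basic invariant
of `G` (as a group acting on all of `V`). -/
def LtTwiceTopDegree {n : ℕ} (d : ℕ) (G : Subgroup (V n ≃ₗᵢ[ℝ] V n)) : Prop :=
  ∃ π : Fin n → MvPolynomial (Fin n) ℝ, IsBasicInvariants G π ∧
    ∃ i, (∀ j, (π j).totalDegree ≤ (π i).totalDegree) ∧ d < 2 * (π i).totalDegree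

/-- The number `ℓ(d)`: the smallest `ℓ` such that for every point `p` outside of the closed
stratum of dimension `ℓ` there is a reflection subgroup `G' ⊆ G` such that `p` is `G'`-general
and `2 dₙ(G') > d`. (`ℓ = n` always has this property, as the `n`-th stratum is `V`.) -/
noncomputable def strNum {n : ℕ} (G : Subgroup (V n ≃ₗᵢ[ℝ] V n)) (d : ℕ) : ℕ :=
  sInf {ℓ : ℕ | ∀ p : V n, p ∉ stratum G ℓ →
    ∃ G' : Subgroup (V n ≃ₗᵢ[ℝ] V n), G' ≤ G ∧ IsReflectionGroup G' ∧ IsGeneral G' p ∧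
      LtTwiceTopDegree d G'}

/-- The number `ℓ'(k) = ℓ(2 dₖ(G))`, with `dₖ(G)` read off from a set `π` of basic invariants
of `G`. The index `k : Fin n` counts from `0`. -/
noncomputable def secStrNum {n : ℕ} (G : Subgroup (V n ≃ₗᵢ[ℝ] V n))
    (π : Fin n → MvPolynomial (Fin n) ℝ) (k : Fin n) : ℕ :=
  strNum G (2 * (π k).totalDegree)

/-- The real variety of `f`. -/
def realVariety {n : ℕ} (f : MvPolynomial (Fin n) ℝ) : Set (V n) := {x | value f x = 0}

/-- `G`-finiteness of an invariant polynomial: there is no zero, or there is a zero `p` such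
that the restriction of `f` to the sphere around the origin through `p` has only finitely many
extreme points, that is, points at which it attains its maximum or its minimum. -/
def IsGFinite {n : ℕ} (f : MvPolynomial (Fin n) ℝ) : Prop :=
  realVariety f = ∅ ∨ ∃ p ∈ realVariety f,
    {q : V n | q ∈ Metric.sphere (0 : V n) ‖p‖ ∧
      IsExtrOn (value f) (Metric.sphere (0 : V n) ‖p‖) q}.Finite

end ReflectionVariety

open ReflectionVariety

/-! If `f` vanishes at `p`, then its minimum on the sphere through `p` is at most 0 and its maximum
at least 0. A stratum is a union of linear subspaces, so if it contains points attaining both, the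
intermediate value theorem on a line through 0 and one of them yields a zero in the stratum. It
remains to locate the extreme points on a sphere that carries only finitely many of them.

Let `q` be such a point outside the stratum of dimension `strNum G d`. Then `q` is general for a
reflection subgroup having a basic invariant `π i` with `d < 2 * deg (π i)`. Basic invariants are
local coordinates at a general point (`IsBasicInvariants.exists_arc`), so nearby one can vary `π i`
alone. If `deg (π i) > 2`, the squared norm does not involve `π i`, and this arc stays on the
sphere. By counting degrees, `f` is affine in `π i`; extremality at the interior parameter 0 kills
the slope, so the whole arc consists of extreme points, a contradiction. The coordinate property
rests on the trivial stabilizer of a general point: summing a Hermite interpolant over the group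
then gives an invariant with any prescribed differential.

For `d` equal to 2 or 3 the degree of `π i` may be 2, and another argument is needed. If `q` is on
no line of the arrangement, there are independent roots `α`, `β` such that neither they nor `refl β
α` are orthogonal to `q`. On `q + span {α, β}`, subtracting a Lagrange multiple of the squared norm
from `f` leaves a polynomial of degree at most 3 with no linear part at `q` and two reflection
symmetries, which must be constant. So `f` is constant where this plane meets the sphere. -/

open scoped RealInnerProductSpace

/-! ### Roots and the trivial stabilizer of a general point -/

namespace ReflectionVariety

variable {n : ℕ}

/-- The orthogonal reflection in the hyperplane orthogonal to `v`. -/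
noncomputable abbrev refl (v : V n) : V n ≃ₗᵢ[ℝ] V n := (hyperplane v).reflection

/-- A root of `G`: a normal vector of a reflection hyperplane. -/
def IsRoot (G : Subgroup (V n ≃ₗᵢ[ℝ] V n)) (v : V n) : Prop := v ≠ 0 ∧ refl v ∈ G

theorem refl_apply (v x : V n) : refl v x = x - (2 * ⟪v, x⟫ / ‖v‖ ^ 2) • v := by
  unfold refl hyperplane
  rw [Submodule.reflection_orthogonal_apply, Submodule.reflection_singleton_apply]
  simp only [neg_sub, RCLike.ofReal_real_eq_id, id]
  rw [two_smul, ← add_smul]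
  congr 2
  ring

theorem refl_apply_of_norm_one {v : V n} (hv : ‖v‖ = 1) (x : V n) :
    refl v x = x - (2 * ⟪v, x⟫) • v := by
  rw [refl_apply, hv]; simp

theorem refl_self (v : V n) : refl v v = -v :=
  Submodule.reflection_orthogonalComplement_singleton_eq_neg v

theorem refl_refl (v x : V n) : refl v (refl v x) = x :=
  Submodule.reflection_reflection _ x

theorem refl_mul_self (v : V n) : refl v * refl v = 1 :=
  Submodule.reflection_mul_reflection _

theorem mem_hyperplane {v x : V n} : x ∈ hyperplane v ↔ ⟪v, x⟫ = 0 :=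
  Submodule.mem_orthogonal_singleton_iff_inner_right

theorem inner_refl_right (v x y : V n) : ⟪x, refl v y⟫ = ⟪refl v x, y⟫ := by
  conv_lhs => rw [← refl_refl v x]
  rw [LinearIsometryEquiv.inner_map_map]

theorem refl_eq_self {v x : V n} (h : ⟪v, x⟫ = 0) : refl v x = x := by
  simp [refl_apply, h]

theorem refl_smul {c : ℝ} (hc : c ≠ 0) (v : V n) : refl (c • v) = refl v := by
  apply LinearIsometryEquiv.ext
  intro x
  rcases eq_or_ne v 0 with rfl | hv
  · simp
  · have : ‖v‖ ≠ 0 := norm_ne_zero_iff.2 hv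
    rw [refl_apply, refl_apply, norm_smul, inner_smul_left, smul_smul, mul_pow, Real.norm_eq_abs,
      sq_abs]
    congr 2
    simp only [conj_trivial]
    field_simp

theorem refl_neg (v : V n) : refl (-v) = refl v := by
  rw [← neg_one_smul ℝ v]; exact refl_smul (by norm_num) v

theorem refl_map (g : V n ≃ₗᵢ[ℝ] V n) (v : V n) : refl (g v) = g * refl v * g⁻¹ := by
  apply LinearIsometryEquiv.ext
  intro x
  obtain ⟨y, rfl⟩ := g.surjective x
  have h : g⁻¹ (g y) = y := g.symm_apply_apply y
  simp only [LinearIsometryEquiv.coe_mul, Function.comp_apply, h]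
  rw [refl_apply, refl_apply, g.inner_map_map, g.norm_map, map_sub, map_smul]

theorem IsRoot.map {G : Subgroup (V n ≃ₗᵢ[ℝ] V n)} {v : V n} (hv : IsRoot G v)
    {g : V n ≃ₗᵢ[ℝ] V n} (hg : g ∈ G) : IsRoot G (g v) := by
  refine ⟨by simpa using hv.1, ?_⟩
  rw [refl_map]
  exact G.mul_mem (G.mul_mem hg hv.2) (G.inv_mem hg)

theorem IsRoot.smul {G : Subgroup (V n ≃ₗᵢ[ℝ] V n)} {v : V n} (hv : IsRoot G v)
    {c : ℝ} (hc : c ≠ 0) : IsRoot G (c • v) :=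
  ⟨smul_ne_zero hc hv.1, by rw [refl_smul hc]; exact hv.2⟩

theorem IsGeneral.inner_ne_zero {G : Subgroup (V n ≃ₗᵢ[ℝ] V n)} {q : V n} (hq : IsGeneral G q)
    {v : V n} (hv : IsRoot G v) : ⟪v, q⟫ ≠ 0 := fun h =>
  hq (hyperplane v) ⟨v, hv.1, hv.2, rfl⟩ (mem_hyperplane.2 h)

/-- The unit roots of `G` that are positive with respect to `q`. -/
def posRoots (G : Subgroup (V n ≃ₗᵢ[ℝ] V n)) (q : V n) : Set (V n) :=
  {v | ‖v‖ = 1 ∧ refl v ∈ G ∧ 0 < ⟪v, q⟫}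

variable {G : Subgroup (V n ≃ₗᵢ[ℝ] V n)} {q : V n}

theorem posRoots.isRoot {v : V n} (hv : v ∈ posRoots G q) : IsRoot G v :=
  ⟨by rintro rfl; simpa using hv.1, hv.2.1⟩

/-- A reflection determines its unit normal up to sign, and positivity fixes the sign. -/
theorem posRoots_finite [Finite G] : (posRoots G q).Finite := by
  refine Set.Finite.of_finite_image (f := refl) ((Set.toFinite (G : Set (V n ≃ₗᵢ[ℝ] V n))).subset ?_) ?_
  · rintro _ ⟨v, hv, rfl⟩
    exact hv.2.1
  · intro u hu v hv huv
    have h1 : v = ⟪u, v⟫ • u := by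
      have h : refl u v = -v := by
        have := refl_self v
        rwa [← huv] at this
      rw [refl_apply_of_norm_one hu.1] at h
      have h2 : (2 : ℝ) • v = (2 : ℝ) • (⟪u, v⟫ • u) := by
        rw [smul_smul, two_smul]
        rw [sub_eq_iff_eq_add] at h
        nth_rewrite 1 [h]
        abel
      exact smul_right_injective _ (two_ne_zero) h2
    have h2 : |⟪u, v⟫| = 1 := by
      have := congrArg norm h1
      rw [norm_smul, hu.1, hv.1, Real.norm_eq_abs] at this
      linarith
    have h3 : 0 < ⟪u, v⟫ := by
      have h4 := hv.2.2
      rw [h1, inner_smul_left] at h4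
      exact pos_of_mul_pos_left h4 hu.2.2.le
    rw [abs_of_pos h3] at h2
    rw [h2, one_smul] at h1
    exact h1.symm

theorem posRoots_map (hq : IsGeneral G q) {g : V n ≃ₗᵢ[ℝ] V n} (hg : g ∈ G) {v : V n}
    (hv : v ∈ posRoots G q) (h : 0 ≤ ⟪g v, q⟫) : g v ∈ posRoots G q := by
  have hr := (posRoots.isRoot hv).map hg
  exact ⟨by rw [g.norm_map, hv.1], hr.2, lt_of_le_of_ne h (hq.inner_ne_zero hr).symm⟩

theorem posRoots_neg_map (hq : IsGeneral G q) {g : V n ≃ₗᵢ[ℝ] V n} (hg : g ∈ G) {v : V n}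
    (hv : v ∈ posRoots G q) (h : ⟪g v, q⟫ ≤ 0) : -(g v) ∈ posRoots G q := by
  have hr := (posRoots.isRoot hv).map hg
  refine ⟨by rw [norm_neg, g.norm_map, hv.1], by rw [refl_neg]; exact hr.2, ?_⟩
  rw [inner_neg_left, neg_pos]
  exact lt_of_le_of_ne h (hq.inner_ne_zero hr)

/-- The simple roots: the positive unit roots `v` such that the reflection `refl v` makes no
positive unit root but `v` negative. -/
def simpleRoots (G : Subgroup (V n ≃ₗᵢ[ℝ] V n)) (q : V n) : Set (V n) :=
  {v | v ∈ posRoots G q ∧ ∀ u ∈ posRoots G q, ⟪refl v u, q⟫ < 0 → u = v}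

/-- Descent on the height `⟪v, q⟫`: the reflection in a non-simple root is conjugate, by a
reflection in a lower root, to a reflection in another lower root. -/
theorem refl_mem_of_posRoot [Finite G] (hq : IsGeneral G q)
    (H : Subgroup (V n ≃ₗᵢ[ℝ] V n)) (hH : ∀ v ∈ simpleRoots G q, refl v ∈ H) :
    ∀ v ∈ posRoots G q, refl v ∈ H := by
  by_contra! hbad
  obtain ⟨v, ⟨hv, hvH⟩, hmin⟩ := Set.exists_min_image {v | v ∈ posRoots G q ∧ refl v ∉ H}
    (fun v => ⟪v, q⟫) (posRoots_finite.subset fun v hv => hv.1) hbad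
  have low : ∀ u ∈ posRoots G q, ⟪u, q⟫ < ⟪v, q⟫ → refl u ∈ H := by
    intro u hu hlt
    by_contra hc
    exact absurd (hmin u ⟨hu, hc⟩) (not_le.2 hlt)
  -- The bounds on `⟪u, v⟫` and the height of `u` put the height of `refl u v` strictly between
  -- `-⟪v, q⟫` and `⟪v, q⟫`; up to sign it is a lower positive root.
  have key : ∀ u ∈ posRoots G q, ⟪u, q⟫ < ⟪v, q⟫ → ⟪u, v⟫ < 1 → 0 < ⟪u, v⟫ → False := by
    intro u hu hlt h1 h0
    have huH := low u hu hlt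
    have hval : ⟪refl u v, q⟫ = ⟪v, q⟫ - 2 * ⟪u, v⟫ * ⟪u, q⟫ := by
      rw [refl_apply_of_norm_one hu.1, inner_sub_left, inner_smul_left]; simp
    have huq := hu.2.2
    have hw : refl (refl u v) ∈ H := by
      rcases le_total 0 ⟪refl u v, q⟫ with h | h
      · exact low _ (posRoots_map hq hu.2.1 hv h) (by rw [hval]; nlinarith)
      · have := low _ (posRoots_neg_map hq hu.2.1 hv h)
          (by rw [inner_neg_left, hval]; nlinarith)
        rwa [refl_neg] at this
    have h2 : refl v = refl u * refl (refl u v) * refl u := by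
      rw [refl_map (refl u) v, show (refl u)⁻¹ = refl u from Submodule.reflection_inv]
      calc refl v = (refl u * refl u) * refl v * (refl u * refl u) := by simp
        _ = _ := by simp only [mul_assoc]
    exact hvH (h2 ▸ H.mul_mem (H.mul_mem huH hw) huH)
  have hns : v ∉ simpleRoots G q := fun h => hvH (hH v h)
  have : ∃ u ∈ posRoots G q, ⟪refl v u, q⟫ < 0 ∧ u ≠ v := by
    by_contra! hc
    exact hns ⟨hv, hc⟩
  obtain ⟨u, hu, hneg, hne⟩ := this
  have hval : ⟪refl v u, q⟫ = ⟪u, q⟫ - 2 * ⟪v, u⟫ * ⟪v, q⟫ := by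
    rw [refl_apply_of_norm_one hv.1, inner_sub_left, inner_smul_left]; simp
  have hsymm : ⟪v, u⟫ = ⟪u, v⟫ := real_inner_comm _ _
  have hlt1 : ⟪u, v⟫ < 1 := (inner_lt_one_iff_real_of_norm_eq_one hu.1 hv.1).2 hne
  have huq := hu.2.2
  have hvq := hv.2.2
  have hpos : 0 < ⟪u, v⟫ := by
    by_contra hc
    nlinarith
  rcases lt_or_ge ⟪u, q⟫ ⟪v, q⟫ with h | h
  · exact key u hu h hlt1 hpos
  -- If `u` is not lower than `v`, then `-(refl v u)` is, and it has the same inner product with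
  -- `v`.
  · have hu' := posRoots_neg_map hq hv.2.1 hu hneg.le
    have hin : ⟪-(refl v u), v⟫ = ⟪u, v⟫ := by
      rw [inner_neg_left, ← inner_refl_right, refl_self, inner_neg_right, neg_neg]
    refine key _ hu' ?_ (by rw [hin]; exact hlt1) (by rw [hin]; exact hpos)
    rw [inner_neg_left, hval]
    nlinarith

/-- Reading the word from the right, some letter `a` first makes the image of `v` negative. By
simplicity that image is `a` itself, so `refl a` is a conjugate of `refl v` and the letter can be
deleted. -/
theorem exchange (hq : IsGeneral G q) {v : V n} (hv : v ∈ posRoots G q) :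
    ∀ L : List (V n), (∀ u ∈ L, u ∈ simpleRoots G q) →
      ⟪(L.map refl).prod v, q⟫ < 0 →
      ∃ M : List (V n), (∀ u ∈ M, u ∈ simpleRoots G q) ∧ M.length + 1 = L.length ∧
        (M.map refl).prod = (L.map refl).prod * refl v := by
  intro L
  induction L with
  | nil =>
    intro _ h
    have := hv.2.2
    simp only [List.map_nil, List.prod_nil, LinearIsometryEquiv.coe_one, id] at h
    linarith
  | cons a L ih =>
    intro hL h
    have ha := hL a (by simp)
    have hL' : ∀ u ∈ L, u ∈ simpleRoots G q := fun u hu => hL u (by simp [hu])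
    have hg : (L.map refl).prod ∈ G := by
      refine G.list_prod_mem ?_
      intro x hx
      obtain ⟨u, hu, rfl⟩ := List.mem_map.1 hx
      exact (hL' u hu).1.2.1
    rcases lt_or_ge ⟪(L.map refl).prod v, q⟫ 0 with hlt | hge
    · obtain ⟨M, hM, hlen, hprod⟩ := ih hL' hlt
      refine ⟨a :: M, ?_, by simp [hlen], by simp [hprod, mul_assoc]⟩
      simp only [List.mem_cons, forall_eq_or_imp]
      exact ⟨ha, hM⟩
    · refine ⟨L, hL', by simp, ?_⟩
      have hpos := posRoots_map hq hg hv hge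
      simp only [List.map_cons, List.prod_cons, LinearIsometryEquiv.coe_mul,
        Function.comp_apply] at h
      have h1 := ha.2 _ hpos h
      have h2 := refl_map (L.map refl).prod v
      rw [h1] at h2
      rw [List.map_cons, List.prod_cons, h2]
      have h3 := refl_mul_self v
      calc (L.map refl).prod = (L.map refl).prod * (refl v * refl v) := by rw [h3, mul_one]
        _ = _ := by group

/-- A point that is general with respect to a finite reflection group has trivial stabilizer. -/
theorem IsGeneral.eq_one_of_apply_eq (hG : IsReflectionGroup G) (hq : IsGeneral G q)
    {g : V n ≃ₗᵢ[ℝ] V n} (hg : g ∈ G) (hgq : g q = q) : g = 1 := by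
  have := hG.finite
  have hpos : ∀ v ∈ posRoots G q, 0 < ⟪g v, q⟫ := by
    intro v hv
    conv_rhs => rw [← hgq]
    rw [g.inner_map_map]
    exact hv.2.2
  have hgH : g ∈ Subgroup.closure (refl '' simpleRoots G q) := by
    have hle : G ≤ Subgroup.closure (refl '' simpleRoots G q) := by
      conv_lhs => rw [← hG.generated]
      rw [Subgroup.closure_le]
      rintro _ ⟨hs, v, hv, rfl⟩
      have hr : IsRoot G v := ⟨hv, hs⟩
      have hB := refl_mem_of_posRoot hq (Subgroup.closure (refl '' simpleRoots G q))
        (fun u hu => Subgroup.subset_closure ⟨u, hu, rfl⟩)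
      have hn : ‖v‖ ≠ 0 := norm_ne_zero_iff.2 hv
      have hvq := hq.inner_ne_zero hr
      rcases lt_or_gt_of_ne hvq with h | h
      · have hc : -‖v‖⁻¹ ≠ 0 := neg_ne_zero.2 (inv_ne_zero hn)
        have := hB (-‖v‖⁻¹ • v) ⟨?_, (hr.smul hc).2, ?_⟩
        · rwa [refl_smul hc] at this
        · rw [norm_smul, norm_neg, norm_inv, norm_norm, inv_mul_cancel₀ hn]
        · rw [inner_smul_left]
          simp only [conj_trivial]
          have : 0 < ‖v‖⁻¹ := inv_pos.2 (norm_pos_iff.2 hv)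
          nlinarith
      · have hc : ‖v‖⁻¹ ≠ 0 := inv_ne_zero hn
        have := hB (‖v‖⁻¹ • v) ⟨?_, (hr.smul hc).2, ?_⟩
        · rwa [refl_smul hc] at this
        · rw [norm_smul, norm_inv, norm_norm, inv_mul_cancel₀ hn]
        · rw [inner_smul_left]
          simp only [conj_trivial]
          have : 0 < ‖v‖⁻¹ := inv_pos.2 (norm_pos_iff.2 hv)
          positivity
    exact hle hg
  have hword : ∀ x ∈ Subgroup.closure (refl '' simpleRoots G q), ∃ k, ∃ L : List (V n),
      L.length = k ∧ (∀ u ∈ L, u ∈ simpleRoots G q) ∧ (L.map refl).prod = x := by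
    intro x hx
    induction hx using Subgroup.closure_induction'' with
    | one => exact ⟨0, [], by simp⟩
    | mul x y hx hy ihx ihy =>
      obtain ⟨_, L, -, hL, rfl⟩ := ihx
      obtain ⟨_, M, -, hM, rfl⟩ := ihy
      refine ⟨_, L ++ M, rfl, fun u hu => ?_, by simp⟩
      exact (List.mem_append.1 hu).elim (hL u) (hM u)
    | mem x hx =>
      obtain ⟨v, hv, rfl⟩ := hx
      exact ⟨1, [v], by simp [hv]⟩
    | inv_mem x hx =>
      obtain ⟨v, hv, rfl⟩ := hx
      exact ⟨1, [v], by simp [hv]⟩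
  have hex := hword g hgH
  classical
  -- Take a shortest word for `g`. Since `g` keeps positive roots positive, the word without its
  -- last letter `v` sends `v` to a negative root, and exchange yields a word for `g` two letters
  -- shorter.
  obtain ⟨L, hlen, hL, hprod⟩ := Nat.find_spec hex
  rcases List.eq_nil_or_concat L with rfl | ⟨L', v, rfl⟩
  · simpa using hprod.symm
  · exfalso
    rw [List.concat_eq_append] at *
    have hv : v ∈ simpleRoots G q := hL v (by simp)
    have hL' : ∀ u ∈ L', u ∈ simpleRoots G q := fun u hu => hL u (by simp [hu])
    simp only [List.map_append, List.map_cons, List.map_nil, List.prod_append, List.prod_cons,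
      List.prod_nil, mul_one] at hprod
    have hneg : ⟪(L'.map refl).prod v, q⟫ < 0 := by
      have h1 := hpos v hv.1
      rw [← hprod, LinearIsometryEquiv.coe_mul, Function.comp_apply, refl_self, map_neg,
        inner_neg_left] at h1
      linarith
    obtain ⟨M, hM, hMlen, hMprod⟩ := exchange hq hv.1 L' hL' hneg
    have := Nat.find_min' hex ⟨M, rfl, hM, hMprod.trans hprod⟩
    rw [← hlen] at this
    simp at this
    omega

end ReflectionVariety

/-! ### Basic invariants as local coordinates -/

namespace ReflectionVariety

variable {n : ℕ}

theorem analyticAt_value (f : MvPolynomial (Fin n) ℝ) (x : V n) : AnalyticAt ℝ (value f) x :=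
  AnalyticOnNhd.eval_continuousLinearMap' (fun i => (EuclideanSpace.proj i : V n →L[ℝ] ℝ)) f x
    (Set.mem_univ x)

theorem differentiable_value (f : MvPolynomial (Fin n) ℝ) : Differentiable ℝ (value f) :=
  fun x => (analyticAt_value f x).differentiableAt

theorem continuous_value (f : MvPolynomial (Fin n) ℝ) : Continuous (value f) :=
  (differentiable_value f).continuous

theorem exists_value_eq_linear (L : V n →ₗ[ℝ] ℝ) :
    ∃ p : MvPolynomial (Fin n) ℝ, ∀ x, value p x = L x := by
  refine ⟨∑ j, MvPolynomial.C (L (EuclideanSpace.basisFun (Fin n) ℝ j)) * MvPolynomial.X j, ?_⟩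
  intro x
  conv_rhs => rw [← (EuclideanSpace.basisFun (Fin n) ℝ).sum_repr x]
  simp only [value, map_sum, map_mul, MvPolynomial.eval_C, MvPolynomial.eval_X, map_smul,
    smul_eq_mul, EuclideanSpace.basisFun_repr]
  exact Finset.sum_congr rfl fun j _ => mul_comm _ _

theorem exists_value_eq_comp (h : MvPolynomial (Fin n) ℝ) (g : V n ≃ₗᵢ[ℝ] V n) :
    ∃ p : MvPolynomial (Fin n) ℝ, ∀ x, value p x = value h (g x) := by
  choose p hp using fun i : Fin n => exists_value_eq_linear
    ((EuclideanSpace.proj i : V n →L[ℝ] ℝ).toLinearMap ∘ₗ g.toLinearEquiv.toLinearMap)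
  refine ⟨MvPolynomial.aeval p h, fun x => ?_⟩
  simp only [value] at hp ⊢
  rw [← MvPolynomial.aeval_eq_eval, MvPolynomial.comp_aeval_apply,
    MvPolynomial.aeval_eq_eval]
  congr 2
  ext i
  exact hp i x

theorem exists_mem_invariants_sum (G : Subgroup (V n ≃ₗᵢ[ℝ] V n)) [Fintype G]
    (h : MvPolynomial (Fin n) ℝ) :
    ∃ F ∈ invariants G, ∀ x, value F x = ∑ g : G, value h (g.1 x) := by
  choose p hp using fun g : G => exists_value_eq_comp h g.1
  have hval : ∀ x, value (∑ g, p g) x = ∑ g : G, value h (g.1 x) := by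
    intro x
    simp only [value, map_sum] at hp ⊢
    exact Finset.sum_congr rfl fun g _ => hp g x
  refine ⟨∑ g, p g, ?_, hval⟩
  intro a ha x
  rw [hval, hval]
  exact Fintype.sum_equiv (Equiv.mulRight (⟨a, ha⟩ : G)) _ _ fun g => rfl

theorem exists_value_eq_norm_sub_sq (s : V n) :
    ∃ p : MvPolynomial (Fin n) ℝ, ∀ x, value p x = ‖x - s‖ ^ 2 := by
  refine ⟨∑ i, (MvPolynomial.X i - MvPolynomial.C (s i)) ^ 2, fun x => ?_⟩
  rw [EuclideanSpace.real_norm_sq_eq]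
  simp [value]

theorem hasFDerivAt_value (f : MvPolynomial (Fin n) ℝ) (x : V n) :
    HasFDerivAt (value f) (fderiv ℝ (value f) x) x := (differentiable_value f x).hasFDerivAt

theorem fderiv_value_mul (p r : MvPolynomial (Fin n) ℝ) (x : V n) :
    fderiv ℝ (value (p * r)) x =
      value p x • fderiv ℝ (value r) x + value r x • fderiv ℝ (value p) x := by
  have : value (p * r) = value p * value r := by ext y; simp [value]
  rw [this, fderiv_mul (differentiable_value p x) (differentiable_value r x)]

/-- Hermite interpolation of a linear form at one point of a finite set, with vanishing
differential at the others. -/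
theorem exists_fderiv_value_eq (S : Finset (V n)) (q : V n) (hq : q ∉ S) (L : V n →L[ℝ] ℝ) :
    ∃ h : MvPolynomial (Fin n) ℝ, fderiv ℝ (value h) q = L ∧
      ∀ s ∈ S, fderiv ℝ (value h) s = 0 := by
  choose D hD using fun s : V n => exists_value_eq_norm_sub_sq s
  obtain ⟨l, hl⟩ := exists_value_eq_linear L.toLinearMap
  set P := ∏ s ∈ S, D s with hP
  have hPq : value P q ≠ 0 := by
    have : value P q = ∏ s ∈ S, ‖q - s‖ ^ 2 := by
      simp only [value] at hD
      simp [hP, value, map_prod, hD]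
    rw [this, Finset.prod_ne_zero_iff]
    intro s hs
    have : q - s ≠ 0 := sub_ne_zero.2 (by rintro rfl; exact hq hs)
    positivity
  have hPs : ∀ s ∈ S, value P s = 0 := by
    intro s hs
    simp only [value] at hD
    simp only [hP, value, map_prod, hD]
    exact Finset.prod_eq_zero hs (by simp)
  -- The square of `P` gives vanishing differentials on `S`; the last factor vanishes at `q`, so
  -- only its own differential survives there, and the constant normalizes it.
  refine ⟨P * (P * (MvPolynomial.C ((value P q)⁻¹ ^ 2) * (l - MvPolynomial.C (L q)))), ?_, ?_⟩
  · have h1 : value (l - MvPolynomial.C (L q)) = fun x => L x - L q := by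
      ext x; have := hl x; simp only [value] at this; simp [value, this]
    have h2 : fderiv ℝ (value (l - MvPolynomial.C (L q))) q = L := by
      rw [h1, fderiv_sub_const, L.fderiv]
    have h3 : value (l - MvPolynomial.C (L q)) q = 0 := by rw [h1]; simp
    have h4 : value (P * (MvPolynomial.C ((value P q)⁻¹ ^ 2) * (l - MvPolynomial.C (L q)))) q = 0 := by
      simp only [value] at h3 ⊢
      simp only [map_mul, h3, mul_zero]
    have h5 : value (MvPolynomial.C ((value P q)⁻¹ ^ 2) * (l - MvPolynomial.C (L q))) q = 0 := by
      simp only [value] at h3 ⊢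
      simp only [map_mul, h3, mul_zero]
    rw [fderiv_value_mul, h4, zero_smul, add_zero, fderiv_value_mul, h5, zero_smul, add_zero,
      fderiv_value_mul, h3, zero_smul, add_zero, h2, smul_smul, smul_smul]
    have h6 : value (MvPolynomial.C ((value P q)⁻¹ ^ 2)) q = (value P q)⁻¹ ^ 2 := by
      simp [value]
    rw [h6]
    convert one_smul ℝ L
    field_simp
  · intro s hs
    have h0 := hPs s hs
    have h4 : value (P * (MvPolynomial.C ((value P q)⁻¹ ^ 2) * (l - MvPolynomial.C (L q)))) s = 0 := by
      simp only [value] at h0 ⊢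
      simp only [map_mul, h0, zero_mul]
    rw [fderiv_value_mul, h4, h0, zero_smul, zero_smul, add_zero]

/-- At a general point, the differentials of invariant polynomials are arbitrary. -/
theorem exists_invariant_fderiv_eq {G : Subgroup (V n ≃ₗᵢ[ℝ] V n)} (hG : IsReflectionGroup G)
    {q : V n} (hq : IsGeneral G q) (L : V n →L[ℝ] ℝ) :
    ∃ F ∈ invariants G, fderiv ℝ (value F) q = L := by
  classical
  have := hG.finite
  have := Fintype.ofFinite G
  obtain ⟨h, hh, hS⟩ := exists_fderiv_value_eq
    ((Finset.univ.image fun g : G => g.1 q).erase q) q (by simp) L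
  obtain ⟨F, hF, hval⟩ := exists_mem_invariants_sum G h
  refine ⟨F, hF, ?_⟩
  have h1 : HasFDerivAt (value F)
      (∑ g : G, (fderiv ℝ (value h) (g.1 q)).comp (g.1.toContinuousLinearEquiv : V n →L[ℝ] V n)) q := by
    have : value F = fun x => ∑ g : G, value h (g.1 x) := funext hval
    rw [this]
    exact HasFDerivAt.fun_sum fun g _ =>
      (hasFDerivAt_value h (g.1 q)).comp q g.1.toContinuousLinearEquiv.hasFDerivAt
  -- By the trivial stabilizer, every `g ≠ 1` moves `q` to another orbit point, where the
  -- interpolant has zero differential.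
  rw [h1.fderiv, Finset.sum_eq_single (1 : G)]
  · ext x
    simp [hh]
  · intro g _ hg
    rw [hS, ContinuousLinearMap.zero_comp]
    refine Finset.mem_erase.2 ⟨fun h => hg ?_, Finset.mem_image_of_mem _ (Finset.mem_univ g)⟩
    exact Subtype.ext (hq.eq_one_of_apply_eq hG g.2 h)
  · simp

/-- The map `V → ℝⁿ` given by a family of polynomials. -/
noncomputable def polyMap (π : Fin n → MvPolynomial (Fin n) ℝ) (x : V n) : Fin n → ℝ :=
  fun i => value (π i) x

theorem value_aeval (π : Fin n → MvPolynomial (Fin n) ℝ) (Q : MvPolynomial (Fin n) ℝ) (x : V n) :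
    value (MvPolynomial.aeval π Q) x = MvPolynomial.eval (polyMap π x) Q := by
  simp only [value]
  rw [← MvPolynomial.aeval_eq_eval, MvPolynomial.comp_aeval_apply,
    MvPolynomial.aeval_eq_eval]
  rfl

theorem IsBasicInvariants.exists_aeval_eq {G : Subgroup (V n ≃ₗᵢ[ℝ] V n)}
    {π : Fin n → MvPolynomial (Fin n) ℝ} (hπ : IsBasicInvariants G π)
    {f : MvPolynomial (Fin n) ℝ} (hf : f ∈ invariants G) :
    ∃ Q : MvPolynomial (Fin n) ℝ, MvPolynomial.aeval π Q = f := by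
  rw [← hπ.generates, Algebra.adjoin_range_eq_range_aeval] at hf
  exact hf

theorem fderiv_value_eq_zero_of_mem_adjoin {S : Set (MvPolynomial (Fin n) ℝ)} {q w : V n}
    (hS : ∀ p ∈ S, fderiv ℝ (value p) q w = 0) {f : MvPolynomial (Fin n) ℝ}
    (hf : f ∈ Algebra.adjoin ℝ S) : fderiv ℝ (value f) q w = 0 := by
  induction hf using Algebra.adjoin_induction with
  | mem p hp => exact hS p hp
  | algebraMap r =>
    have : value (algebraMap ℝ (MvPolynomial (Fin n) ℝ) r) = fun _ => r := by
      ext x; simp [value, MvPolynomial.algebraMap_eq]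
    rw [this]; simp
  | add a b _ _ ha hb =>
    have : value (a + b) = value a + value b := by ext x; simp [value]
    rw [this, fderiv_add (differentiable_value a q) (differentiable_value b q)]
    simp [ha, hb]
  | mul a b _ _ ha hb =>
    rw [fderiv_value_mul]
    simp [ha, hb]

/-- Near a general point, basic invariants are local coordinates: there is an arc along which one
of them varies and the others are fixed. -/
theorem IsBasicInvariants.exists_arc {G : Subgroup (V n ≃ₗᵢ[ℝ] V n)} (hG : IsReflectionGroup G)
    {π : Fin n → MvPolynomial (Fin n) ℝ} (hπ : IsBasicInvariants G π)
    {q : V n} (hq : IsGeneral G q) (i : Fin n) :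
    ∃ (x : ℝ → V n) (ε : ℝ), 0 < ε ∧ ∀ t, |t| < ε →
      polyMap π (x t) = Function.update (polyMap π q) i (polyMap π q i + t) := by
  let D : V n →L[ℝ] (Fin n → ℝ) := ContinuousLinearMap.pi fun j => fderiv ℝ (value (π j)) q
  have hD : HasStrictFDerivAt (polyMap π) D q :=
    hasStrictFDerivAt_pi.2 fun j => (analyticAt_value (π j) q).hasStrictFDerivAt
  -- A vector `w` killed by all `dπ j` is killed by the differential of every invariant, and `⟪w,
  -- ·⟫` is one of these; hence `⟪w, w⟫ = 0`.
  have hinj : Function.Injective D := by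
    rw [injective_iff_map_eq_zero]
    intro w hw
    obtain ⟨F, hF, hFq⟩ := exists_invariant_fderiv_eq hG hq (innerSL ℝ w)
    have h0 : fderiv ℝ (value F) q w = 0 := by
      refine fderiv_value_eq_zero_of_mem_adjoin (S := Set.range π) ?_ (by rwa [hπ.generates])
      rintro _ ⟨j, rfl⟩
      exact congrFun hw j
    rw [hFq] at h0
    simpa using h0
  have hsurj : Function.Surjective D :=
    (LinearMap.injective_iff_surjective_of_finrank_eq_finrank (f := D.toLinearMap) (by simp)).1 hinj
  have hsurj' : D.range = ⊤ := LinearMap.range_eq_top.2 hsurj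
  have hmap := hD.map_nhds_eq_of_surj hsurj'
  have hnhds : Set.range (polyMap π) ∈ nhds (polyMap π q) := by
    rw [← hmap]
    exact Filter.mem_map.2 (Filter.univ_mem' fun x => Set.mem_range_self x)
  have hc : Filter.Tendsto (fun t : ℝ => Function.update (polyMap π q) i (polyMap π q i + t))
      (nhds 0) (nhds (polyMap π q)) := by
    have : Continuous (fun t : ℝ => Function.update (polyMap π q) i (polyMap π q i + t)) := by
      fun_prop
    simpa using this.tendsto 0
  obtain ⟨ε, hε, h⟩ := Metric.eventually_nhds_iff.1 (hc.eventually hnhds)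
  -- Only the coordinates of the arc matter, so preimages are chosen pointwise, without continuity,
  -- and arbitrarily for large `t`.
  have h' : ∀ t : ℝ, ∃ x, |t| < ε →
      polyMap π x = Function.update (polyMap π q) i (polyMap π q i + t) := by
    intro t
    by_cases ht : |t| < ε
    · obtain ⟨x, hx⟩ := h (y := t) (by simpa using ht)
      exact ⟨x, fun _ => hx⟩
    · exact ⟨0, fun h => absurd h ht⟩
  choose x hx using h'
  exact ⟨x, ε, hε, hx⟩

end ReflectionVariety

/-! ### Degree counting and isolated extreme points -/

namespace ReflectionVariety

variable {n : ℕ}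

theorem isHomogeneous_aeval_of_isWeightedHomogeneous {σ τ : Type*} (d : σ → ℕ)
    {π : σ → MvPolynomial τ ℝ} (hπ : ∀ i, (π i).IsHomogeneous (d i)) {k : ℕ}
    {Q : MvPolynomial σ ℝ} (hQ : Q.IsWeightedHomogeneous d k) :
    (MvPolynomial.aeval π Q).IsHomogeneous k := by
  rw [MvPolynomial.aeval_def, MvPolynomial.eval₂_eq]
  refine MvPolynomial.IsHomogeneous.sum _ _ _ fun m hm => ?_
  rw [MvPolynomial.algebraMap_eq]
  have hk : k = ∑ i ∈ m.support, d i * m i := by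
    rw [← hQ (MvPolynomial.mem_support_iff.1 hm), Finsupp.weight_apply, Finsupp.sum]
    exact Finset.sum_congr rfl fun i _ => by rw [smul_eq_mul, mul_comm]
  rw [hk]
  exact (MvPolynomial.IsHomogeneous.prod _ _ _ fun i _ => (hπ i).pow (m i)).C_mul _

/-- A polynomial expression in homogeneous polynomials can be chosen without superfluous
monomials. -/
theorem exists_aeval_eq_of_isHomogeneous {σ τ : Type*} [Fintype σ] (d : σ → ℕ)
    {π : σ → MvPolynomial τ ℝ} (hπ : ∀ i, (π i).IsHomogeneous (d i)) (Q : MvPolynomial σ ℝ) :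
    ∃ R : MvPolynomial σ ℝ, MvPolynomial.aeval π R = MvPolynomial.aeval π Q ∧
      ∀ m ∈ R.support, ∀ i, m i * d i ≤ (MvPolynomial.aeval π Q).totalDegree := by
  classical
  set f := MvPolynomial.aeval π Q with hf
  set W := fun k => MvPolynomial.weightedHomogeneousComponent d k Q with hW
  have hWh : ∀ k, (MvPolynomial.aeval π (W k)).IsHomogeneous k := fun k =>
    isHomogeneous_aeval_of_isWeightedHomogeneous d hπ
      (MvPolynomial.weightedHomogeneousComponent_isWeightedHomogeneous k Q)
  set N := MvPolynomial.weightedTotalDegree d Q + f.totalDegree + 1 with hN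
  have hQ : Q = ∑ k ∈ Finset.range N, W k := by
    ext m
    rw [MvPolynomial.coeff_sum]
    simp only [hW, MvPolynomial.coeff_weightedHomogeneousComponent]
    by_cases hm : m ∈ Q.support
    · have := MvPolynomial.le_weightedTotalDegree d hm
      rw [Finset.sum_ite_eq, if_pos (Finset.mem_range.2 (by omega))]
    · rw [MvPolynomial.notMem_support_iff.1 hm]
      simp
  have hcomp : ∀ k ∈ Finset.range (f.totalDegree + 1),
      MvPolynomial.homogeneousComponent k f = MvPolynomial.aeval π (W k) := by
    intro k hk
    rw [hf]
    conv_lhs => rw [hQ]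
    rw [map_sum, map_sum, Finset.sum_eq_single k]
    · rw [MvPolynomial.homogeneousComponent_of_mem (hWh k), if_pos rfl]
    · intro j _ hj
      rw [MvPolynomial.homogeneousComponent_of_mem (hWh j), if_neg hj.symm]
    · intro h
      rw [Finset.mem_range] at hk h
      omega
  -- Components of weight above `deg f` contribute nothing to `f`, so they may be dropped; algebraic
  -- independence plays no role.
  refine ⟨∑ k ∈ Finset.range (f.totalDegree + 1), W k, ?_, ?_⟩
  · rw [map_sum, ← Finset.sum_congr rfl hcomp, MvPolynomial.sum_homogeneousComponent]
  · intro m hm i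
    rw [MvPolynomial.mem_support_iff, MvPolynomial.coeff_sum] at hm
    obtain ⟨k, hk, hne⟩ := Finset.exists_ne_zero_of_sum_ne_zero hm
    simp only [hW, MvPolynomial.coeff_weightedHomogeneousComponent] at hne
    have hw : Finsupp.weight d m = k := by
      by_contra h
      simp [h] at hne
    have h1 : m i * d i ≤ Finsupp.weight d m := by
      by_cases hi : i ∈ m.support
      · rw [Finsupp.weight_apply, Finsupp.sum]
        exact Finset.single_le_sum (f := fun i => m i • d i) (fun _ _ => Nat.zero_le _) hi
      · rw [Finsupp.notMem_support_iff.1 hi]; simp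
    rw [Finset.mem_range] at hk
    omega

theorem exists_eval_update_eq {σ : Type*} [Fintype σ] [DecidableEq σ] {Q : MvPolynomial σ ℝ}
    {i : σ} (hQ : ∀ m ∈ Q.support, m i ≤ 1) (y : σ → ℝ) :
    ∃ B : ℝ, ((∀ m ∈ Q.support, m i = 0) → B = 0) ∧
      ∀ t, MvPolynomial.eval (Function.update y i (y i + t)) Q = MvPolynomial.eval y Q + t * B := by
  refine ⟨∑ m ∈ Q.support, if m i = 0 then 0 else
    Q.coeff m * ∏ j ∈ Finset.univ.erase i, y j ^ m j, ?_, fun t => ?_⟩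
  · intro h
    exact Finset.sum_eq_zero fun m hm => if_pos (h m hm)
  · rw [MvPolynomial.eval_eq', MvPolynomial.eval_eq', Finset.mul_sum, ← Finset.sum_add_distrib]
    refine Finset.sum_congr rfl fun m hm => ?_
    rw [← Finset.mul_prod_erase _ _ (Finset.mem_univ i), ← Finset.mul_prod_erase Finset.univ
      (fun j => y j ^ m j) (Finset.mem_univ i), Function.update_self]
    have h : ∏ j ∈ Finset.univ.erase i, Function.update y i (y i + t) j ^ m j =
        ∏ j ∈ Finset.univ.erase i, y j ^ m j :=
      Finset.prod_congr rfl fun j hj => by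
        rw [Function.update_of_ne (Finset.ne_of_mem_erase hj)]
    rw [h]
    have h1 := hQ m hm
    rcases Nat.le_one_iff_eq_zero_or_eq_one.1 h1 with h0 | h0 <;> simp [h0]
    ring

variable {G : Subgroup (V n ≃ₗᵢ[ℝ] V n)} {π : Fin n → MvPolynomial (Fin n) ℝ}

/-- Invariants of small degree are affine in a basic invariant of large degree. -/
theorem IsBasicInvariants.exists_value_affine (hπ : IsBasicInvariants G π)
    {f : MvPolynomial (Fin n) ℝ} (hf : f ∈ invariants G) {i : Fin n}
    (hd : f.totalDegree < 2 * (π i).totalDegree) (q : V n) :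
    ∃ B : ℝ, (f.totalDegree < (π i).totalDegree → B = 0) ∧ ∀ x t,
      polyMap π x = Function.update (polyMap π q) i (polyMap π q i + t) →
        value f x = value f q + t * B := by
  obtain ⟨Q, rfl⟩ := hπ.exists_aeval_eq hf
  obtain ⟨R, hR, hdeg⟩ := exists_aeval_eq_of_isHomogeneous _ hπ.homogeneous Q
  have h1 : ∀ m ∈ R.support, m i ≤ 1 := by
    intro m hm
    have := hdeg m hm i
    by_contra hc
    have : 2 * (π i).totalDegree ≤ m i * (π i).totalDegree := Nat.mul_le_mul_right _ (by omega)
    omega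
  obtain ⟨B, hB0, hB⟩ := exists_eval_update_eq h1 (polyMap π q)
  refine ⟨B, fun h => hB0 fun m hm => ?_, fun x t hx => ?_⟩
  · have := hdeg m hm i
    by_contra hc
    have : 1 * (π i).totalDegree ≤ m i * (π i).totalDegree := Nat.mul_le_mul_right _ (by omega)
    omega
  · rw [← hR, value_aeval, value_aeval, hx, hB]

theorem exists_normSq (n : ℕ) : ∃ N : MvPolynomial (Fin n) ℝ, N.totalDegree ≤ 2 ∧
    (∀ G : Subgroup (V n ≃ₗᵢ[ℝ] V n), N ∈ invariants G) ∧ ∀ x, value N x = ‖x‖ ^ 2 := by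
  have hval : ∀ x : V n, value (∑ i, MvPolynomial.X i ^ 2) x = ‖x‖ ^ 2 := by
    intro x
    rw [EuclideanSpace.real_norm_sq_eq]
    simp [value]
  refine ⟨∑ i, MvPolynomial.X i ^ 2, ?_, ?_, hval⟩
  · exact (MvPolynomial.IsHomogeneous.sum _ _ 2 fun i _ => by
      simpa using (MvPolynomial.isHomogeneous_X ℝ i).pow 2).totalDegree_le
  · intro G g _ x
    rw [hval, hval, g.norm_map]

/-- If `f` is affine in a basic invariant of degree at least three, then the general extreme
points on a sphere are not isolated. -/
theorem IsBasicInvariants.infinite_extr (hG : IsReflectionGroup G) (hπ : IsBasicInvariants G π)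
    {q : V n} (hq : IsGeneral G q) {i : Fin n} (hi : 2 < (π i).totalDegree)
    {f : MvPolynomial (Fin n) ℝ} {B : ℝ} (hB : ∀ x t,
      polyMap π x = Function.update (polyMap π q) i (polyMap π q i + t) →
        value f x = value f q + t * B)
    (hext : IsExtrOn (value f) (Metric.sphere (0 : V n) ‖q‖) q) :
    {y : V n | y ∈ Metric.sphere (0 : V n) ‖q‖ ∧
      IsExtrOn (value f) (Metric.sphere (0 : V n) ‖q‖) y}.Infinite := by
  obtain ⟨x, ε, hε, hx⟩ := hπ.exists_arc hG hq i
  obtain ⟨N, hN2, hN, hNval⟩ := exists_normSq n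
  -- The squared norm has degree 2, less than that of `π i`, so it is constant along the arc.
  have hsph : ∀ t, |t| < ε → x t ∈ Metric.sphere (0 : V n) ‖q‖ := by
    intro t ht
    obtain ⟨C, hC0, hC⟩ := hπ.exists_value_affine (hN G) (i := i) (by omega) q
    have := hC (x t) t (hx t ht)
    rw [hC0 (by omega), hNval, hNval, mul_zero, add_zero] at this
    rw [mem_sphere_zero_iff_norm]
    exact (sq_eq_sq₀ (norm_nonneg _) (norm_nonneg _)).1 this
  have hval : ∀ t, |t| < ε → value f (x t) = value f q + t * B := fun t ht => hB _ _ (hx t ht)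
  -- An affine function with an extremum at an interior point has slope zero; compare `t = ε / 2`
  -- and `t = -ε / 2`.
  have hB0 : B = 0 := by
    have e1 : |ε / 2| < ε := by rw [abs_of_pos (by linarith)]; linarith
    have e2 : |-(ε / 2)| < ε := by rwa [abs_neg]
    have v1 := hval _ e1
    have v2 := hval _ e2
    rcases hext with h | h
    · have h1 := isMinOn_iff.1 h _ (hsph _ e1)
      have h2 := isMinOn_iff.1 h _ (hsph _ e2)
      nlinarith
    · have h1 := isMaxOn_iff.1 h _ (hsph _ e1)
      have h2 := isMaxOn_iff.1 h _ (hsph _ e2)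
      nlinarith
  refine Set.infinite_of_injOn_mapsTo (s := Set.Ioo 0 ε) (f := x) ?_ ?_ (Set.Ioo_infinite hε)
  · intro s hs t ht hst
    have h1 := hx s (by rw [abs_of_pos hs.1]; exact hs.2)
    have h2 := hx t (by rw [abs_of_pos ht.1]; exact ht.2)
    rw [hst, h2] at h1
    have := congrFun h1 i
    simp only [Function.update_self] at this
    linarith
  · intro t ht
    have ht' : |t| < ε := by rw [abs_of_pos ht.1]; exact ht.2
    refine ⟨hsph t ht', ?_⟩
    have hv : value f (x t) = value f q := by rw [hval t ht', hB0]; ring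
    rcases hext with h | h
    · exact Or.inl (isMinOn_iff.2 fun y hy => hv ▸ isMinOn_iff.1 h y hy)
    · exact Or.inr (isMaxOn_iff.2 fun y hy => hv ▸ isMaxOn_iff.1 h y hy)

theorem mem_stratum_finrank (G : Subgroup (V n ≃ₗᵢ[ℝ] V n)) (p : V n) : p ∈ stratum G n :=
  ⟨⊤, ⟨∅, Set.empty_subset _, sInf_empty.symm⟩, by simp, trivial⟩

theorem strNum_spec (G : Subgroup (V n ≃ₗᵢ[ℝ] V n)) (d : ℕ) {p : V n}
    (hp : p ∉ stratum G (strNum G d)) :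
    ∃ G' : Subgroup (V n ≃ₗᵢ[ℝ] V n), G' ≤ G ∧ IsReflectionGroup G' ∧ IsGeneral G' p ∧
      LtTwiceTopDegree d G' :=
  Nat.sInf_mem (s := {ℓ : ℕ | ∀ p : V n, p ∉ stratum G ℓ →
    ∃ G' : Subgroup (V n ≃ₗᵢ[ℝ] V n), G' ≤ G ∧ IsReflectionGroup G' ∧ IsGeneral G' p ∧
      LtTwiceTopDegree d G'}) ⟨n, fun p hp => absurd (mem_stratum_finrank G p) hp⟩ p hp

theorem strNum_le (G : Subgroup (V n ≃ₗᵢ[ℝ] V n)) (d : ℕ) : strNum G d ≤ n :=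
  Nat.sInf_le fun p hp => absurd (mem_stratum_finrank G p) hp

theorem invariants_anti {G H : Subgroup (V n ≃ₗᵢ[ℝ] V n)} (h : G ≤ H)
    {f : MvPolynomial (Fin n) ℝ} (hf : f ∈ invariants H) : f ∈ invariants G :=
  fun g hg x => hf g (h hg) x

/-- Isolated extreme points of an invariant of degree `d ≥ 4` lie in the stratum of dimension
`strNum G d`. -/
theorem mem_stratum_strNum_of_isExtrOn {f : MvPolynomial (Fin n) ℝ} (hf : f ∈ invariants G)
    (hd : 4 ≤ f.totalDegree) {q : V n}
    (hext : IsExtrOn (value f) (Metric.sphere (0 : V n) ‖q‖) q)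
    (hfin : {y : V n | y ∈ Metric.sphere (0 : V n) ‖q‖ ∧
      IsExtrOn (value f) (Metric.sphere (0 : V n) ‖q‖) y}.Finite) :
    q ∈ stratum G (strNum G f.totalDegree) := by
  by_contra hq
  obtain ⟨G', hle, hG', hgen, π, hπ, i, -, hi⟩ := strNum_spec G _ hq
  obtain ⟨B, -, hB⟩ := hπ.exists_value_affine (invariants_anti hle hf) hi q
  -- Here `4 ≤ deg f < 2 * deg (π i)` forces `deg (π i) > 2`; this is what fails in degrees 2 and 3.
  exact hπ.infinite_extr hG' hgen (by omega) hB hext hfin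

/-- Isolated extreme points of a polynomial in invariants of degree at most `d`, where `d ≥ 2`,
lie in the stratum of dimension `strNum G (2 * d)`. -/
theorem mem_stratum_strNum_two_mul_of_isExtrOn {S : Set (MvPolynomial (Fin n) ℝ)} {d : ℕ}
    (hd : 2 ≤ d) (hS : ∀ p ∈ S, p ∈ invariants G ∧ p.totalDegree ≤ d)
    {f : MvPolynomial (Fin n) ℝ} (hf : f ∈ Algebra.adjoin ℝ S) {q : V n}
    (hext : IsExtrOn (value f) (Metric.sphere (0 : V n) ‖q‖) q)
    (hfin : {y : V n | y ∈ Metric.sphere (0 : V n) ‖q‖ ∧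
      IsExtrOn (value f) (Metric.sphere (0 : V n) ‖q‖) y}.Finite) :
    q ∈ stratum G (strNum G (2 * d)) := by
  by_contra hq
  obtain ⟨G', hle, hG', hgen, π, hπ, i, -, hi⟩ := strNum_spec G _ hq
  -- Each generator has degree at most `d < deg (π i)`, so it does not involve `π i`, and neither
  -- does `f`: the slope is 0 whatever the degree of `f`.
  refine hπ.infinite_extr hG' hgen (i := i) (B := 0) (by omega) (fun x t hx => ?_) hext hfin
  rw [mul_zero, add_zero]
  clear hext hfin
  induction hf using Algebra.adjoin_induction with
  | mem p hp =>
    have h2 := (hS p hp).2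
    obtain ⟨B, hB0, hB⟩ := hπ.exists_value_affine (invariants_anti hle (hS p hp).1) (i := i)
      (by omega) q
    rw [hB x t hx, hB0 (by omega), mul_zero, add_zero]
  | algebraMap r => simp [value, MvPolynomial.algebraMap_eq]
  | add a b _ _ ha hb => simp only [value, map_add] at *; rw [ha, hb]
  | mul a b _ _ ha hb => simp only [value, map_mul] at *; rw [ha, hb]

end ReflectionVariety

/-! ### Flats and roots of essential groups -/

namespace ReflectionVariety

variable {n : ℕ} {G : Subgroup (V n ≃ₗᵢ[ℝ] V n)}

theorem exists_isRoot_inner_ne_zero (hG : IsReflectionGroup G) (hess : IsEssential G) {x : V n}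
    (hx : x ≠ 0) : ∃ v, IsRoot G v ∧ ⟪v, x⟫ ≠ 0 := by
  by_contra! h
  refine hx (hess x fun g hg => ?_)
  rw [← hG.generated] at hg
  induction hg using Subgroup.closure_induction with
  | mem g hg =>
    obtain ⟨hgG, v, hv, rfl⟩ := hg
    exact refl_eq_self (h v ⟨hv, hgG⟩)
  | one => rfl
  | mul a b _ _ ha hb => rw [LinearIsometryEquiv.coe_mul, Function.comp_apply, hb, ha]
  | inv a _ ha =>
    conv_lhs => rw [← ha]
    exact a.symm_apply_apply x

theorem eq_top_of_forall_isRoot_mem (hG : IsReflectionGroup G) (hess : IsEssential G)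
    {K : Submodule ℝ (V n)} (hK : ∀ v, IsRoot G v → v ∈ K) : K = ⊤ := by
  by_contra h
  obtain ⟨x, hx, hx0⟩ := Submodule.exists_mem_ne_zero_of_ne_bot
    (mt Submodule.orthogonal_eq_bot_iff.1 h)
  obtain ⟨v, hv, hvx⟩ := exists_isRoot_inner_ne_zero hG hess hx0
  exact hvx (Submodule.inner_right_of_mem_orthogonal (hK v hv) hx)

theorem isFlat_top (G : Subgroup (V n ≃ₗᵢ[ℝ] V n)) : IsFlat G ⊤ :=
  ⟨∅, Set.empty_subset _, sInf_empty.symm⟩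

theorem IsFlat.inf_hyperplane {F : Submodule ℝ (V n)} (hF : IsFlat G F) {v : V n}
    (hv : IsRoot G v) : IsFlat G (F ⊓ hyperplane v) := by
  obtain ⟨S, hS, rfl⟩ := hF
  refine ⟨insert (hyperplane v) S, ?_, by rw [sInf_insert, inf_comm]⟩
  rintro H (rfl | hH)
  · exact ⟨v, hv.1, hv.2, rfl⟩
  · exact hS hH

theorem finrank_inf_hyperplane {F : Submodule ℝ (V n)} {v x : V n} (hx : x ∈ F)
    (h : ⟪v, x⟫ ≠ 0) : Module.finrank ℝ (F ⊓ hyperplane v : Submodule ℝ (V n)) + 1 =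
      Module.finrank ℝ F := by
  have hφ : (innerSL ℝ v).toLinearMap ∘ₗ F.subtype ≠ 0 := fun h0 =>
    h (by simpa using LinearMap.congr_fun h0 ⟨x, hx⟩)
  rw [← Module.Dual.finrank_ker_add_one_of_ne_zero hφ]
  have hH : hyperplane v = LinearMap.ker (innerSL ℝ v).toLinearMap := by
    ext y; simp [mem_hyperplane]
  rw [LinearMap.ker_comp, ← Submodule.finrank_map_subtype_eq, Submodule.map_comap_subtype, hH]

theorem exists_isFlat_finrank_eq (hG : IsReflectionGroup G) (hess : IsEssential G) (j : ℕ)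
    (hj : j ≤ n) : ∃ F, IsFlat G F ∧ Module.finrank ℝ F + j = n := by
  induction j with
  | zero => exact ⟨⊤, isFlat_top G, by simp⟩
  | succ j ih =>
    obtain ⟨F, hF, hrank⟩ := ih (by omega)
    have : F ≠ ⊥ := by
      rintro rfl
      simp at hrank
      omega
    obtain ⟨x, hx, hx0⟩ := Submodule.exists_mem_ne_zero_of_ne_bot this
    obtain ⟨v, hv, hvx⟩ := exists_isRoot_inner_ne_zero hG hess hx0
    have := finrank_inf_hyperplane hx hvx
    exact ⟨_, hF.inf_hyperplane hv, by omega⟩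

/-- For an essential group, cutting successively by suitable mirrors gives flats of every dimension
from `n` down to 0, so none of these strata is empty. -/
theorem zero_mem_stratum (hG : IsReflectionGroup G) (hess : IsEssential G) {k : ℕ} (hk : k ≤ n) :
    (0 : V n) ∈ stratum G k := by
  obtain ⟨F, hF, hrank⟩ := exists_isFlat_finrank_eq hG hess (n - k) (Nat.sub_le _ _)
  exact ⟨F, hF, by omega, F.zero_mem⟩

/-! ### Restrictions to affine planes and invariants of low degree -/

/-- The functions on the plane that are polynomials of degree at most `d`. -/
def planePoly (d : ℕ) : Submodule ℝ (ℝ × ℝ → ℝ) :=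
  Submodule.span ℝ {φ | ∃ i j, i + j ≤ d ∧ φ = fun p => p.1 ^ i * p.2 ^ j}

theorem planePoly_mono {d e : ℕ} (h : d ≤ e) : planePoly d ≤ planePoly e := by
  refine Submodule.span_mono ?_
  rintro _ ⟨i, j, hij, rfl⟩
  exact ⟨i, j, hij.trans h, rfl⟩

theorem planePoly_mul_mem {d e : ℕ} {φ ψ : ℝ × ℝ → ℝ} (hφ : φ ∈ planePoly d)
    (hψ : ψ ∈ planePoly e) : φ * ψ ∈ planePoly (d + e) := by
  have h := Submodule.mul_mem_mul hφ hψ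
  unfold planePoly at h
  rw [Submodule.span_mul_span] at h
  refine Submodule.span_mono ?_ h
  rintro _ ⟨_, ⟨i, j, hij, rfl⟩, _, ⟨k, l, hkl, rfl⟩, rfl⟩
  refine ⟨i + k, j + l, by omega, ?_⟩
  ext p
  simp only [Pi.mul_apply]
  ring

theorem one_mem_planePoly : (1 : ℝ × ℝ → ℝ) ∈ planePoly 0 :=
  Submodule.subset_span ⟨0, 0, le_rfl, by ext; simp⟩

theorem planePoly_pow_mem {φ : ℝ × ℝ → ℝ} (hφ : φ ∈ planePoly 1) (k : ℕ) :
    φ ^ k ∈ planePoly k := by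
  induction k with
  | zero => simpa using one_mem_planePoly
  | succ k ih => rw [pow_succ]; exact planePoly_mul_mem ih hφ

theorem planePoly_prod_mem {ι : Type*} (s : Finset ι) (φ : ι → ℝ × ℝ → ℝ) (m : ι → ℕ)
    (h : ∀ i ∈ s, φ i ∈ planePoly (m i)) : ∏ i ∈ s, φ i ∈ planePoly (∑ i ∈ s, m i) := by
  classical
  induction s using Finset.induction_on with
  | empty => simpa using one_mem_planePoly
  | insert a s ha ih =>
    rw [Finset.prod_insert ha, Finset.sum_insert ha]
    exact planePoly_mul_mem (h a (Finset.mem_insert_self a s))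
      (ih fun i hi => h i (Finset.mem_insert_of_mem hi))

theorem value_plane_mem_planePoly (f : MvPolynomial (Fin n) ℝ) (a b c : V n) :
    (fun p : ℝ × ℝ => value f (a + p.1 • b + p.2 • c)) ∈ planePoly f.totalDegree := by
  have h1 : ∀ i, (fun p : ℝ × ℝ => (a + p.1 • b + p.2 • c) i) ∈ planePoly 1 := by
    intro i
    have e : (fun p : ℝ × ℝ => (a + p.1 • b + p.2 • c) i) =
        a i • (fun p : ℝ × ℝ => p.1 ^ 0 * p.2 ^ 0) + b i • (fun p : ℝ × ℝ => p.1 ^ 1 * p.2 ^ 0) +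
          c i • (fun p : ℝ × ℝ => p.1 ^ 0 * p.2 ^ 1) := by
      ext p
      simp
      ring
    rw [e]
    refine add_mem (add_mem ?_ ?_) ?_ <;>
    · refine Submodule.smul_mem _ _ (Submodule.subset_span ⟨_, _, ?_, rfl⟩)
      norm_num
  have h2 : (fun p : ℝ × ℝ => value f (a + p.1 • b + p.2 • c)) =
      ∑ m ∈ f.support, f.coeff m • ∏ i ∈ m.support,
        (fun p : ℝ × ℝ => (a + p.1 • b + p.2 • c) i) ^ m i := by
    ext p
    simp only [value, Finset.sum_apply, Pi.smul_apply, Finset.prod_apply, Pi.pow_apply, smul_eq_mul]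
    rw [MvPolynomial.eval_eq]
  rw [h2]
  refine Submodule.sum_mem _ fun m hm => Submodule.smul_mem _ _ ?_
  exact planePoly_mono (MvPolynomial.le_totalDegree hm)
    (planePoly_prod_mem _ _ _ fun i _ => planePoly_pow_mem (h1 i) _)

theorem exists_coeff_of_mem_planePoly {d : ℕ} {φ : ℝ × ℝ → ℝ} (hφ : φ ∈ planePoly d) :
    ∃ c : ℕ → ℕ → ℝ, ∀ s t, φ (s, t) =
      ∑ i ∈ Finset.range (d + 1), ∑ j ∈ Finset.range (d + 1 - i), c i j * (s ^ i * t ^ j) := by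
  induction hφ using Submodule.span_induction with
  | mem φ h =>
    obtain ⟨i, j, hij, rfl⟩ := h
    refine ⟨fun k l => if k = i then (if l = j then 1 else 0) else 0, fun s t => ?_⟩
    rw [Finset.sum_eq_single_of_mem i (Finset.mem_range.2 (by omega)),
      Finset.sum_eq_single_of_mem j (Finset.mem_range.2 (by omega))]
    · simp
    · intro l _ hl; simp [hl]
    · intro k _ hk; simp [hk]
  | zero => exact ⟨0, by simp⟩
  | add φ ψ _ _ h1 h2 =>
    obtain ⟨c, hc⟩ := h1
    obtain ⟨e, he⟩ := h2
    refine ⟨c + e, fun s t => ?_⟩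
    rw [Pi.add_apply, hc, he]
    simp only [← Finset.sum_add_distrib, Pi.add_apply, add_mul]
  | smul r φ _ h =>
    obtain ⟨c, hc⟩ := h
    refine ⟨r • c, fun s t => ?_⟩
    rw [Pi.smul_apply, hc]
    simp only [Finset.mul_sum, Pi.smul_apply, smul_eq_mul, mul_assoc]

theorem exists_cubic_coeff {f : MvPolynomial (Fin n) ℝ} (hf : f.totalDegree ≤ 3) (a b c : V n) :
    ∃ c00 c10 c01 c20 c11 c02 c30 c21 c12 c03 : ℝ, ∀ s t : ℝ,
      value f (a + s • b + t • c) = c00 + c10 * s + c01 * t + c20 * s ^ 2 + c11 * s * t +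
        c02 * t ^ 2 + c30 * s ^ 3 + c21 * s ^ 2 * t + c12 * s * t ^ 2 + c03 * t ^ 3 := by
  obtain ⟨k, hk⟩ := exists_coeff_of_mem_planePoly
    (planePoly_mono hf (value_plane_mem_planePoly f a b c))
  refine ⟨k 0 0, k 1 0, k 0 1, k 2 0, k 1 1, k 0 2, k 3 0, k 2 1, k 1 2, k 0 3, fun s t => ?_⟩
  rw [hk s t]
  simp only [Finset.sum_range_succ, Finset.sum_range_zero]
  norm_num
  ring

theorem hasDerivAt_value_line (f : MvPolynomial (Fin n) ℝ) (a b : V n) :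
    HasDerivAt (fun s : ℝ => value f (a + s • b)) (fderiv ℝ (value f) a b) 0 := by
  have h1 : HasDerivAt (fun s : ℝ => a + s • b) b 0 := by
    simpa using ((hasDerivAt_id (0 : ℝ)).smul_const b).const_add a
  have h2 : HasFDerivAt (value f) (fderiv ℝ (value f) a) (a + (0 : ℝ) • b) := by
    simpa using hasFDerivAt_value f a
  exact h2.comp_hasDerivAt (0 : ℝ) h1

theorem eq_of_hasDerivAt_cubic {φ : ℝ → ℝ} {D c0 c1 c2 c3 : ℝ} (h : HasDerivAt φ D 0)
    (hφ : ∀ s, φ s = c0 + c1 * s + c2 * s ^ 2 + c3 * s ^ 3) : D = c1 := by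
  have h1 : HasDerivAt φ (0 + c1 * 1 + c2 * (↑2 * 0 ^ 1) + c3 * (↑3 * 0 ^ 2)) 0 := by
    rw [funext hφ]
    exact (((hasDerivAt_const _ _).add ((hasDerivAt_id _).const_mul _)).add
      ((hasDerivAt_pow 2 _).const_mul _)).add ((hasDerivAt_pow 3 _).const_mul _)
  rw [h.unique h1]
  simp

theorem value_refl {f : MvPolynomial (Fin n) ℝ} (hf : f ∈ invariants G) {v : V n}
    (hv : IsRoot G v) (x : V n) : value f (refl v x) = value f x := hf _ hv.2 x

/-- On a reflection hyperplane, the normal derivative of an invariant vanishes. -/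
theorem fderiv_value_root_eq_zero {f : MvPolynomial (Fin n) ℝ} (hf : f ∈ invariants G) {v x : V n}
    (hv : IsRoot G v) (hx : ⟪v, x⟫ = 0) : fderiv ℝ (value f) x v = 0 := by
  have h1 := hasDerivAt_value_line f x v
  have h2 := hasDerivAt_value_line f x (-v)
  have h3 : (fun s : ℝ => value f (x + s • v)) = fun s : ℝ => value f (x + s • (-v)) := by
    ext s
    rw [← value_refl hf hv, map_add, map_smul, refl_self, refl_eq_self hx]
  rw [h3] at h1
  have := h1.unique h2
  rw [map_neg] at this
  linarith

/-- The origin lies on every mirror, so the differential there kills all roots, and these span. -/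
theorem fderiv_value_zero (hG : IsReflectionGroup G) (hess : IsEssential G)
    {f : MvPolynomial (Fin n) ℝ} (hf : f ∈ invariants G) : fderiv ℝ (value f) 0 = 0 := by
  have h : LinearMap.ker (fderiv ℝ (value f) 0).toLinearMap = ⊤ :=
    eq_top_of_forall_isRoot_mem hG hess fun v hv => by
      simpa using fderiv_value_root_eq_zero hf hv (x := 0) (by simp)
  ext x
  simpa using LinearMap.congr_fun (LinearMap.ker_eq_top.1 h) x

/-- For an essential group, the invariants of degree at most one are constant. -/
theorem value_eq_of_totalDegree_le_one (hG : IsReflectionGroup G) (hess : IsEssential G)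
    {f : MvPolynomial (Fin n) ℝ} (hf : f ∈ invariants G) (hd : f.totalDegree ≤ 1) (x : V n) :
    value f x = value f 0 := by
  obtain ⟨c, hc⟩ := exists_coeff_of_mem_planePoly
    (planePoly_mono hd (value_plane_mem_planePoly f 0 x 0))
  have h : ∀ s : ℝ, value f (0 + s • x) = c 0 0 + c 1 0 * s := by
    intro s
    have := hc s 0
    simpa [Finset.sum_range_succ] using this
  have h1 := eq_of_hasDerivAt_cubic (c0 := c 0 0) (c1 := c 1 0) (c2 := 0) (c3 := 0)
    (hasDerivAt_value_line f 0 x) (fun s => by rw [h s]; ring)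
  rw [fderiv_value_zero hG hess hf] at h1
  have e1 := h 1
  have e0 := h 0
  simp at h1 e0 e1
  rw [e0, e1, ← h1]
  simp

/-- A basic invariant of degree at most one would be constant, contradicting algebraic independence.
-/
theorem IsBasicInvariants.two_le_totalDegree (hG : IsReflectionGroup G) (hess : IsEssential G)
    {π : Fin n → MvPolynomial (Fin n) ℝ} (hπ : IsBasicInvariants G π) (k : Fin n) :
    2 ≤ (π k).totalDegree := by
  by_contra hlt
  have hmem : π k ∈ invariants G := by
    rw [← hπ.generates]
    exact Algebra.subset_adjoin ⟨k, rfl⟩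
  have hval := value_eq_of_totalDegree_le_one hG hess hmem (by omega)
  have h1 : π k = MvPolynomial.C (value (π k) 0) := by
    refine MvPolynomial.funext fun y => ?_
    have := hval (WithLp.toLp 2 y)
    rw [MvPolynomial.eval_C, ← this]
    rfl
  have h2 : MvPolynomial.X k = (MvPolynomial.C (value (π k) 0) : MvPolynomial (Fin n) ℝ) := by
    apply hπ.algebraicIndependent
    rw [MvPolynomial.aeval_X, MvPolynomial.aeval_C, MvPolynomial.algebraMap_eq]
    exact h1
  have h3 := congrArg MvPolynomial.totalDegree h2
  rw [MvPolynomial.totalDegree_X, MvPolynomial.totalDegree_C] at h3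
  omega

end ReflectionVariety

/-! ### Invariants of degree at most three -/

namespace ReflectionVariety

variable {n : ℕ} {G : Subgroup (V n ≃ₗᵢ[ℝ] V n)}

/-- A cubic without linear terms that is invariant under two affine reflections of the plane whose
mirrors (and a further mirror) avoid the origin is constant. -/
theorem cubic_coeff_eq_zero_of_symm {h : ℝ → ℝ → ℝ} {c00 c20 c11 c02 c30 c21 c12 c03 : ℝ}
    (hh : ∀ s t, h s t = c00 + c20 * s ^ 2 + c11 * s * t + c02 * t ^ 2 + c30 * s ^ 3 +
      c21 * s ^ 2 * t + c12 * s * t ^ 2 + c03 * t ^ 3)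
    {P K P' K' : ℝ} (hP : P ≠ 0) (hP' : P' ≠ 0) (hPK : P - K * P' ≠ 0)
    (h1 : ∀ s t, h (-s - P - t * K) t = h s t) (h2 : ∀ s t, h s (-t - P' - s * K') = h s t)
    (s t : ℝ) : h s t = c00 := by
  -- On the axis `t = 0` the symmetry is `s ↦ -s - P`; comparing values at `s = 0` and `s = P` gives
  -- two independent equations.
  have hs : c30 = 0 ∧ c20 = 0 := by
    have a0 := h1 0 0
    have a1 := h1 P 0
    rw [hh, hh] at a0 a1
    have b0 : P ^ 2 * (c20 - c30 * P) = 0 := by linear_combination a0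
    have b1 : P ^ 2 * (3 * c20 - 9 * c30 * P) = 0 := by linear_combination a1
    have hP2 : P ^ 2 ≠ 0 := pow_ne_zero 2 hP
    have b0' := (mul_eq_zero.1 b0).resolve_left hP2
    have b1' := (mul_eq_zero.1 b1).resolve_left hP2
    have : c30 * P = 0 := by linarith
    have h3 := (mul_eq_zero.1 this).resolve_right hP
    exact ⟨h3, by rw [h3] at b0'; linarith⟩
  have ht : c03 = 0 ∧ c02 = 0 := by
    have a0 := h2 0 0
    have a1 := h2 0 P'
    rw [hh, hh] at a0 a1
    have b0 : P' ^ 2 * (c02 - c03 * P') = 0 := by linear_combination a0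
    have b1 : P' ^ 2 * (3 * c02 - 9 * c03 * P') = 0 := by linear_combination a1
    have hP2 : P' ^ 2 ≠ 0 := pow_ne_zero 2 hP'
    have b0' := (mul_eq_zero.1 b0).resolve_left hP2
    have b1' := (mul_eq_zero.1 b1).resolve_left hP2
    have : c03 * P' = 0 := by linarith
    have h3 := (mul_eq_zero.1 this).resolve_right hP'
    exact ⟨h3, by rw [h3] at b0'; linarith⟩
  obtain ⟨rfl, rfl⟩ := hs
  obtain ⟨rfl, rfl⟩ := ht
  -- These points and their mirror images differ by exactly 1 in the moved coordinate, so each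
  -- comparison is linear in `c11`, `c21`, `c12`.
  have a1 := h1 ((1 - (P + K)) / 2) 1
  have a2 := h1 ((1 - (P - K)) / 2) (-1)
  have b1 := h2 1 ((1 - (P' + K')) / 2)
  have b2 := h2 (-1) ((1 - (P' - K')) / 2)
  rw [hh, hh] at a1 a2 b1 b2
  have e1 : c11 = c21 * P := by linear_combination (a2 - a1) / 2
  have e2 : c12 = c21 * K := by linear_combination (-a1 - a2) / 2
  have e3 : c11 = c12 * P' := by linear_combination (b2 - b1) / 2
  have e4 : c21 * (P - K * P') = 0 := by linear_combination e3 - e1 + P' * e2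
  obtain rfl := (mul_eq_zero.1 e4).resolve_right hPK
  rw [zero_mul] at e1 e2
  rw [hh, e1, e2]
  ring

theorem mem_span_orthogonal_iff {S : Set (V n)} {x : V n} :
    x ∈ (Submodule.span ℝ S)ᗮ ↔ ∀ v ∈ S, ⟪v, x⟫ = 0 := by
  refine ⟨fun h v hv => Submodule.inner_right_of_mem_orthogonal (Submodule.subset_span hv) h,
    fun h => (Submodule.mem_orthogonal _ _).2 fun u hu => ?_⟩
  induction hu using Submodule.span_induction with
  | mem v hv => exact h v hv
  | zero => exact inner_zero_left x
  | add u v _ _ hu hv => rw [inner_add_left, hu, hv, add_zero]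
  | smul c u _ hu => rw [inner_smul_left, hu, mul_zero]

/-- The squared norm is regular at `q ≠ 0`, so the multiplier of `f` is nonzero and can be divided
out. -/
theorem exists_lagrange {f : MvPolynomial (Fin n) ℝ} {q : V n} (hq : q ≠ 0)
    (hext : IsExtrOn (value f) (Metric.sphere (0 : V n) ‖q‖) q) :
    ∃ c : ℝ, ∀ w, fderiv ℝ (value f) q w = 2 * c * ⟪q, w⟫ := by
  have hset : Metric.sphere (0 : V n) ‖q‖ = {x | ‖x‖ ^ 2 = ‖q‖ ^ 2} := by
    ext x
    rw [mem_sphere_zero_iff_norm, Set.mem_ofPred_eq, sq_eq_sq₀ (norm_nonneg _) (norm_nonneg _)]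
  rw [hset] at hext
  have h1 := hasStrictFDerivAt_norm_sq (F := V n) q
  have h2 := (analyticAt_value f q).hasStrictFDerivAt
  obtain ⟨a, b, hab, h⟩ := IsLocalExtrOn.exists_multipliers_of_hasStrictFDerivAt_1d
    (f := fun x : V n => ‖x‖ ^ 2) hext.localize h1 h2
  have hw : ∀ w, a * (2 * ⟪q, w⟫) + b * fderiv ℝ (value f) q w = 0 := by
    intro w
    simpa using congrArg (fun T : V n →L[ℝ] ℝ => T w) h
  have hb : b ≠ 0 := by
    rintro rfl
    have := hw q
    rw [real_inner_self_eq_norm_sq] at this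
    have hq' : ‖q‖ ≠ 0 := norm_ne_zero_iff.2 hq
    have ha : a = 0 := by simpa [hq] using this
    exact hab (by rw [ha]; rfl)
  refine ⟨-a / b, fun w => ?_⟩
  field_simp
  linarith [hw w]

/-- If the reflections in two independent roots `α`, `β` and in `refl β α` all move `q`, then `q` is
not an isolated extreme point of an invariant of degree at most three. -/
theorem infinite_extr_of_cubic {f : MvPolynomial (Fin n) ℝ} (hf : f ∈ invariants G)
    (hd : f.totalDegree ≤ 3) {q α β : V n} (hα : IsRoot G α) (hβ : IsRoot G β)
    (hind : LinearIndependent ℝ ![α, β]) (hαq : ⟪α, q⟫ ≠ 0) (hβq : ⟪β, q⟫ ≠ 0)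
    (hγq : ⟪refl β α, q⟫ ≠ 0)
    (hext : IsExtrOn (value f) (Metric.sphere (0 : V n) ‖q‖) q) :
    {y : V n | y ∈ Metric.sphere (0 : V n) ‖q‖ ∧
      IsExtrOn (value f) (Metric.sphere (0 : V n) ‖q‖) y}.Infinite := by
  have hq : q ≠ 0 := by rintro rfl; simp at hαq
  obtain ⟨l, hl⟩ := exists_lagrange hq hext
  have hA : ‖α‖ ≠ 0 := norm_ne_zero_iff.2 hα.1
  have hB : ‖β‖ ≠ 0 := norm_ne_zero_iff.2 hβ.1
  obtain ⟨c00, c10, c01, c20, c11, c02, c30, c21, c12, c03, hc⟩ := exists_cubic_coeff hd q α β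
  have h10 : 2 * l * ⟪q, α⟫ = c10 := by
    rw [← hl α]
    refine eq_of_hasDerivAt_cubic (c0 := c00) (c2 := c20) (c3 := c30)
      (hasDerivAt_value_line f q α) fun s => ?_
    have := hc s 0
    rw [zero_smul, add_zero] at this
    rw [this]; ring
  have h01 : 2 * l * ⟪q, β⟫ = c01 := by
    rw [← hl β]
    refine eq_of_hasDerivAt_cubic (c0 := c00) (c2 := c02) (c3 := c03)
      (hasDerivAt_value_line f q β) fun s => ?_
    have := hc 0 s
    rw [zero_smul, add_zero] at this
    rw [this]; ring
  have hnorm : ∀ s t : ℝ, ‖q + s • α + t • β‖ ^ 2 = ‖q‖ ^ 2 + 2 * s * ⟪q, α⟫ + 2 * t * ⟪q, β⟫ +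
      s ^ 2 * ‖α‖ ^ 2 + 2 * s * t * ⟪α, β⟫ + t ^ 2 * ‖β‖ ^ 2 := by
    intro s t
    rw [norm_add_sq_real, norm_add_sq_real, inner_add_left]
    simp only [inner_smul_left, inner_smul_right, norm_smul, conj_trivial, mul_pow,
      Real.norm_eq_abs, sq_abs]
    ring
  have hconst : ∀ s t : ℝ, value f (q + s • α + t • β) - l * ‖q + s • α + t • β‖ ^ 2 =
      c00 - l * ‖q‖ ^ 2 := by
    refine cubic_coeff_eq_zero_of_symm
      (c20 := c20 - l * ‖α‖ ^ 2) (c11 := c11 - 2 * l * ⟪α, β⟫) (c02 := c02 - l * ‖β‖ ^ 2)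
      (c30 := c30) (c21 := c21) (c12 := c12) (c03 := c03)
      (h := fun s t => value f (q + s • α + t • β) - l * ‖q + s • α + t • β‖ ^ 2)
      (P := 2 * ⟪α, q⟫ / ‖α‖ ^ 2) (K := 2 * ⟪α, β⟫ / ‖α‖ ^ 2)
      (P' := 2 * ⟪β, q⟫ / ‖β‖ ^ 2) (K' := 2 * ⟪β, α⟫ / ‖β‖ ^ 2) ?_ ?_ ?_ ?_ ?_ ?_
    · intro s t
      simp only [hc, hnorm]
      linear_combination -s * h10 - t * h01
    · positivity
    · positivity
    -- Up to the factor `2 / ‖α‖ ^ 2`, the quantity `P - K * P'` is `⟪refl β α, q⟫`.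
    · rw [refl_apply, inner_sub_left, inner_smul_left, conj_trivial] at hγq
      intro h0
      apply hγq
      rw [real_inner_comm β α] at h0
      field_simp at h0 ⊢
      linarith
    · intro s t
      have e : q + (-s - 2 * ⟪α, q⟫ / ‖α‖ ^ 2 - t * (2 * ⟪α, β⟫ / ‖α‖ ^ 2)) • α + t • β =
          refl α (q + s • α + t • β) := by
        rw [map_add, map_add, map_smul, map_smul, refl_self, refl_apply, refl_apply]
        module
      simp only [e, LinearIsometryEquiv.norm_map, value_refl hf hα]
    · intro s t
      have e : q + s • α + (-t - 2 * ⟪β, q⟫ / ‖β‖ ^ 2 - s * (2 * ⟪β, α⟫ / ‖β‖ ^ 2)) • β =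
          refl β (q + s • α + t • β) := by
        rw [map_add, map_add, map_smul, map_smul, refl_self, refl_apply, refl_apply]
        module
      simp only [e, LinearIsometryEquiv.norm_map, value_refl hf hβ]
  have hval : ∀ s t : ℝ, q + s • α + t • β ∈ Metric.sphere (0 : V n) ‖q‖ →
      value f (q + s • α + t • β) = value f q := by
    intro s t hst
    have h1 := hconst s t
    have h0 := hconst 0 0
    rw [mem_sphere_zero_iff_norm.1 hst] at h1
    simp only [zero_smul, add_zero] at h0
    linarith
  have hpair := LinearIndependent.pair_iff.1 hind
  -- Reflecting `q` along `α + c • β`, generally not a root, parametrizes points of the plane on the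
  -- sphere; the excluded `c` is the one for which this vector is orthogonal to `q`.
  refine Set.infinite_of_injOn_mapsTo (s := {-⟪α, q⟫ / ⟪β, q⟫}ᶜ)
    (f := fun c : ℝ => refl (α + c • β) q) ?_ ?_ (Set.finite_singleton _).infinite_compl
  · have hk : ∀ c ∈ ({-⟪α, q⟫ / ⟪β, q⟫}ᶜ : Set ℝ),
        2 * ⟪α + c • β, q⟫ / ‖α + c • β‖ ^ 2 ≠ 0 := by
      intro c hc
      have h1 : α + c • β ≠ 0 := fun h0 => one_ne_zero (hpair 1 c (by simpa using h0)).1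
      have h2 : ⟪α + c • β, q⟫ ≠ 0 := by
        intro h0
        rw [inner_add_left, inner_smul_left, conj_trivial] at h0
        refine hc ?_
        rw [Set.mem_singleton_iff]
        field_simp
        linarith
      have : ‖α + c • β‖ ≠ 0 := norm_ne_zero_iff.2 h1
      positivity
    intro c hc e he hce
    simp only [refl_apply, sub_right_inj] at hce
    have hkc := hk c hc
    set k := 2 * ⟪α + c • β, q⟫ / ‖α + c • β‖ ^ 2
    set k' := 2 * ⟪α + e • β, q⟫ / ‖α + e • β‖ ^ 2
    obtain ⟨h1, h2⟩ := hpair (k - k') (k * c - k' * e) (by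
      rw [← sub_eq_zero] at hce
      rw [← hce]
      module)
    have h3 : k' = k := by linarith
    rw [h3] at h2
    exact mul_left_cancel₀ hkc (by linarith)
  · intro c _
    have hsph : refl (α + c • β) q ∈ Metric.sphere (0 : V n) ‖q‖ := by
      rw [mem_sphere_zero_iff_norm, LinearIsometryEquiv.norm_map]
    have e : refl (α + c • β) q = q + (-(2 * ⟪α + c • β, q⟫ / ‖α + c • β‖ ^ 2)) • α +
        (-(2 * ⟪α + c • β, q⟫ / ‖α + c • β‖ ^ 2) * c) • β := by
      rw [refl_apply]
      module
    have hv : value f (refl (α + c • β) q) = value f q := by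
      rw [e] at hsph ⊢
      exact hval _ _ hsph
    refine ⟨hsph, ?_⟩
    rcases hext with h | h
    · exact Or.inl (isMinOn_iff.2 fun y hy => hv ▸ isMinOn_iff.1 h y hy)
    · exact Or.inr (isMaxOn_iff.2 fun y hy => hv ▸ isMaxOn_iff.1 h y hy)

/-- Isolated extreme points of an invariant of degree at most three lie on lines of the
arrangement. -/
theorem mem_stratum_one_of_isExtrOn (hG : IsReflectionGroup G) (hess : IsEssential G)
    {f : MvPolynomial (Fin n) ℝ} (hf : f ∈ invariants G) (hd : f.totalDegree ≤ 3) {q : V n}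
    (hq : q ≠ 0) (hext : IsExtrOn (value f) (Metric.sphere (0 : V n) ‖q‖) q)
    (hfin : {y : V n | y ∈ Metric.sphere (0 : V n) ‖q‖ ∧
      IsExtrOn (value f) (Metric.sphere (0 : V n) ‖q‖) y}.Finite) :
    q ∈ stratum G 1 := by
  obtain ⟨α, hα, hαq⟩ := exists_isRoot_inner_ne_zero hG hess hq
  set N : Submodule ℝ (V n) := Submodule.span ℝ {v | IsRoot G v ∧ ⟪v, q⟫ = 0} with hN
  set L : Submodule ℝ (V n) := N ⊔ Submodule.span ℝ {α} with hL
  have hNL : ∀ v, IsRoot G v → ⟪v, q⟫ = 0 → v ∈ L := fun v hv hvq =>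
    (le_sup_left : N ≤ L) (Submodule.subset_span ⟨hv, hvq⟩)
  have hαL : α ∈ L := (le_sup_right : _ ≤ L) (Submodule.mem_span_singleton_self α)
  -- A root `β` outside `L` would be independent of `α` and not orthogonal to `q`. Nor is `refl β
  -- α`: otherwise it lies in `L`, which forces `refl β α = α`. This is the forbidden cubic
  -- configuration.
  have hLtop : L = ⊤ := by
    refine eq_top_of_forall_isRoot_mem hG hess fun β hβ => ?_
    by_contra hβL
    have hβq : ⟪β, q⟫ ≠ 0 := fun h0 => hβL (hNL β hβ h0)
    refine infinite_extr_of_cubic hf hd hα hβ ?_ hαq hβq ?_ hext hfin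
    · rw [LinearIndependent.pair_iff]
      intro s t hst
      have ht : t = 0 := by
        by_contra ht
        refine hβL ?_
        have : β = (-(t⁻¹ * s)) • α := by
          have h1 : t • β = (-s) • α := by
            rw [neg_smul, eq_neg_iff_add_eq_zero, add_comm]
            exact hst
          rw [neg_mul_eq_mul_neg, ← smul_smul, ← h1, smul_smul, inv_mul_cancel₀ ht, one_smul]
        rw [this]
        exact L.smul_mem _ hαL
      rw [ht, zero_smul, add_zero] at hst
      exact ⟨(smul_eq_zero.1 hst).resolve_right hα.1, ht⟩
    · intro h0
      have h1 := hNL _ (hα.map hβ.2) h0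
      have h2 : (2 * ⟪β, α⟫ / ‖β‖ ^ 2) • β ∈ L := by
        have := L.sub_mem hαL h1
        rwa [refl_apply, sub_sub_cancel] at this
      have h3 : 2 * ⟪β, α⟫ / ‖β‖ ^ 2 = 0 := by
        by_contra hk
        exact hβL ((L.smul_mem_iff hk).1 h2)
      rw [refl_apply, h3, zero_smul, sub_zero] at h0
      exact hαq h0
  have hqN : q ∈ Nᗮ := mem_span_orthogonal_iff.2 fun v hv => hv.2
  refine ⟨Nᗮ, ⟨{H | ∃ v, IsRoot G v ∧ ⟪v, q⟫ = 0 ∧ H = hyperplane v}, ?_, ?_⟩, ?_, ?_⟩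
  · rintro H ⟨v, hv, -, rfl⟩
    exact ⟨v, hv.1, hv.2, rfl⟩
  · ext x
    rw [Submodule.mem_sInf, hN, mem_span_orthogonal_iff]
    constructor
    · rintro h _ ⟨v, hv, hvq, rfl⟩
      exact mem_hyperplane.2 (h v ⟨hv, hvq⟩)
    · rintro h v ⟨hv, hvq⟩
      exact mem_hyperplane.1 (h _ ⟨v, hv, hvq, rfl⟩)
  -- `Nᗮ` meets the mirror of `α` in `Lᗮ = ⊥` and is not contained in it, so it is a line.
  · rw [← finrank_inf_hyperplane hqN hαq]
    have : Nᗮ ⊓ hyperplane α = ⊥ := by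
      rw [hyperplane, Submodule.inf_orthogonal, ← hL, hLtop, Submodule.top_orthogonal_eq_bot]
    rw [this, finrank_bot]
  · exact hqN

end ReflectionVariety

/-! ### From extreme points to zeros -/

namespace ReflectionVariety

variable {n : ℕ} {G : Subgroup (V n ≃ₗᵢ[ℝ] V n)}

/-- The points `a` and `b` may lie in different flats, but both flats contain 0; the sign of `f`
there decides which of the lines `ℝ a`, `ℝ b` carries a zero. -/
theorem exists_zero_mem_stratum {f : MvPolynomial (Fin n) ℝ} {k : ℕ} {a b : V n}
    (ha : a ∈ stratum G k) (hb : b ∈ stratum G k) (hfa : value f a ≤ 0) (hfb : 0 ≤ value f b) :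
    (realVariety f ∩ stratum G k).Nonempty := by
  have hline : ∀ x : V n, Continuous fun t : ℝ => value f (t • x) := fun x =>
    (continuous_value f).comp (continuous_id.smul continuous_const)
  have hmem : ∀ x ∈ stratum G k, ∀ t : ℝ, t • x ∈ stratum G k := by
    rintro x ⟨F, hF, hk, hx⟩ t
    exact ⟨F, hF, hk, F.smul_mem t hx⟩
  rcases le_total 0 (value f 0) with h0 | h0
  · obtain ⟨t, ht⟩ := mem_range_of_exists_le_of_exists_ge (hline a) (c := 0)
      ⟨1, by rwa [one_smul]⟩ ⟨0, by rwa [zero_smul]⟩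
    exact ⟨t • a, ht, hmem a ha t⟩
  · obtain ⟨t, ht⟩ := mem_range_of_exists_le_of_exists_ge (hline b) (c := 0)
      ⟨0, by rwa [zero_smul]⟩ ⟨1, by rwa [one_smul]⟩
    exact ⟨t • b, ht, hmem b hb t⟩

/-- A stratum that contains the isolated extreme points on spheres detects real zeros. -/
theorem nonempty_realVariety_iff {f : MvPolynomial (Fin n) ℝ} (hfin : IsGFinite f) {k : ℕ}
    (h : ∀ q : V n, IsExtrOn (value f) (Metric.sphere (0 : V n) ‖q‖) q →
      {y : V n | y ∈ Metric.sphere (0 : V n) ‖q‖ ∧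
        IsExtrOn (value f) (Metric.sphere (0 : V n) ‖q‖) y}.Finite → q ∈ stratum G k) :
    (realVariety f).Nonempty ↔ (realVariety f ∩ stratum G k).Nonempty := by
  refine ⟨fun hne => ?_, fun hne => hne.mono Set.inter_subset_left⟩
  obtain ⟨p, hp, hpfin⟩ := hfin.resolve_left hne.ne_empty
  have hpS : p ∈ Metric.sphere (0 : V n) ‖p‖ := mem_sphere_zero_iff_norm.2 rfl
  have hp0 : value f p = 0 := hp
  obtain ⟨a, ha, hmin⟩ := (isCompact_sphere (0 : V n) ‖p‖).exists_isMinOn ⟨p, hpS⟩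
    (continuous_value f).continuousOn
  obtain ⟨b, hb, hmax⟩ := (isCompact_sphere (0 : V n) ‖p‖).exists_isMaxOn ⟨p, hpS⟩
    (continuous_value f).continuousOn
  refine exists_zero_mem_stratum (a := a) (b := b) (h a ?_ ?_) (h b ?_ ?_)
    (hp0 ▸ isMinOn_iff.1 hmin p hpS) (hp0 ▸ isMaxOn_iff.1 hmax p hpS)
  · rw [mem_sphere_zero_iff_norm.1 ha]; exact Or.inl hmin
  · rwa [mem_sphere_zero_iff_norm.1 ha]
  · rw [mem_sphere_zero_iff_norm.1 hb]; exact Or.inr hmax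
  · rwa [mem_sphere_zero_iff_norm.1 hb]

end ReflectionVariety

theorem theorem4p3 (n : ℕ)
    (G : Subgroup (EuclideanSpace ℝ (Fin n) ≃ₗᵢ[ℝ] EuclideanSpace ℝ (Fin n)))
    (hG : IsReflectionGroup G) (hess : IsEssential G)
    (f : MvPolynomial (Fin n) ℝ) (hf : f ∈ invariants G) (hfin : IsGFinite f) :
    (∀ π : Fin n → MvPolynomial (Fin n) ℝ, IsBasicInvariants G π →
      ∀ k : Fin n, f ∈ Algebra.adjoin ℝ (π '' Set.Iic k) →
        ((realVariety f).Nonempty ↔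
          (realVariety f ∩ stratum G (secStrNum G π k)).Nonempty)) ∧
    (f.totalDegree ≠ 2 → f.totalDegree ≠ 3 →
      ((realVariety f).Nonempty ↔
        (realVariety f ∩ stratum G (strNum G f.totalDegree)).Nonempty)) ∧
    (f.totalDegree = 2 ∨ f.totalDegree = 3 →
      ((realVariety f).Nonempty ↔ (realVariety f ∩ stratum G 1).Nonempty)) := by
  refine ⟨fun π hπ k hfk => ?_, fun h2 h3 => ?_, fun h => ?_⟩
  · refine nonempty_realVariety_iff hfin fun q hext hq => ?_
    refine mem_stratum_strNum_two_mul_of_isExtrOn (hπ.two_le_totalDegree hG hess k) ?_ hfk hext hq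
    rintro _ ⟨j, hj, rfl⟩
    exact ⟨hπ.generates ▸ Algebra.subset_adjoin ⟨j, rfl⟩, hπ.ordered hj⟩
  · rcases le_or_gt f.totalDegree 1 with h1 | h1
    -- In degree at most one `f` is constant, so any zero moves to the origin.
    · refine ⟨fun ⟨p, hp⟩ => ⟨0, ?_, zero_mem_stratum hG hess (strNum_le G _)⟩,
        fun hne => hne.mono Set.inter_subset_left⟩
      exact (value_eq_of_totalDegree_le_one hG hess hf h1 p).symm.trans hp
    · exact nonempty_realVariety_iff hfin fun q =>
        mem_stratum_strNum_of_isExtrOn hf (by omega)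
  -- For `n = 0` every polynomial has degree 0. The bound is needed when the extreme point is the
  -- origin, which must lie in the stratum of dimension 1.
  · have hn : 1 ≤ n := by
      rcases Nat.eq_zero_or_pos n with rfl | hn
      · have := (MvPolynomial.isHomogeneous_of_isEmpty (f := f)).totalDegree_le
        omega
      · exact hn
    refine nonempty_realVariety_iff hfin fun q hext hq => ?_
    rcases eq_or_ne q 0 with rfl | hq0
    · exact zero_mem_stratum hG hess hn
    · exact mem_stratum_one_of_isExtrOn hG hess hf (by omega) hq0 hext hq
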